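/- Let $\Bbbk$ be a field and let $C$ be a cocommutative $\Bbbk$-coalgebra that is cosemisimple, i.e. a direct sum of simple coalgebras (a simple coalgebra being one with no subcoalgebras other than $0$ and itself). Let $\mathrm{Coalg}\,C$ be the category whose objects are the coalgebra morphisms $\phi:D\to C$ with $D$ a cocommutative $\Bbbk$-coalgebra, and whose morphisms from $\phi:D\to C$ to $\psi:E\to C$ are the coalgebra morphisms $f:D\to E$ with $\psi\circ f=\phi$. Let $\mathrm{Vec}^C$ be the category of $C$-comodules $(V,v:V\to V\otimes C)$ and comodule morphisms. For comodules $(V,v)$, $(W,w)$ let the cotensor product $V\otimes^C W$ be the equalizer of $v\otimes \mathrm{id}_W$ and $\mathrm{id}_V\otimes(\tau\circ w)$ from $V\otimes W$ to $V\otimes C\otimes W$ ($\tau$ being the transposition), with the coaction induced by $\mathrm{id}_V\otimes w$. Let $U^C:\mathrm{Coalg}\,C\to \mathrm{Vec}^C$ be the functor that takes $\phi:D\to C$ to the space $D$ with the coaction $(\mathrm{id}_D\otimes\phi)\circ\Delta_D$ and a morphism to its underlying linear map. Then $\mathrm{Coalg}\,C$ has finite products; $(\mathrm{Vec}^C,\otimes^C,C)$,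 with the associativity, unit and symmetry isomorphisms induced by those of $\otimes$ and by the counit of $C$, is a closed symmetric monoidal category; and $U^C$ has a right adjoint $R^C$ such that $U^C\dashv R^C$ is an LNL adjunction with $U^C$ strong monoidal. That is, $U^C$ and $R^C$ carry structures of (lax) monoidal functors between $(\mathrm{Coalg}\,C,\times,\mathrm{id}_C)$ and $(\mathrm{Vec}^C,\otimes^C,C)$ for which the unit and the counit of the adjunction are monoidal natural transformations, and the structure morphisms of $U^C$ are isomorphisms. -/

import Mathlib

open CategoryTheory MonoidalCategory
open scoped TensorProduct

universe u

namespace ComodLNL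

section Linear

variable {k : Type u} [Field k] {C : Type u} [AddCommGroup C] [Module k C]
variable {M N P M' N' A B : Type u}
  [AddCommGroup M] [Module k M] [AddCommGroup N] [Module k N] [AddCommGroup P] [Module k P]
  [AddCommGroup M'] [Module k M'] [AddCommGroup N'] [Module k N']
  [AddCommGroup A] [Module k A] [AddCommGroup B] [Module k B]

/-- A map `a : M → M ⊗ C` acting on the first factor of `M ⊗ N`. -/
noncomputable def actL (a : M →ₗ[k] M ⊗[k] C) (N : Type u) [AddCommGroup N] [Module k N] :
    M ⊗[k] N →ₗ[k] (M ⊗[k] N) ⊗[k] C :=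
  (TensorProduct.rightComm k M C N).toLinearMap ∘ₗ a.rTensor N

/-- A map `b : N → N ⊗ C` acting on the second factor of `M ⊗ N`. -/
noncomputable def actR (M : Type u) [AddCommGroup M] [Module k M] (b : N →ₗ[k] N ⊗[k] C) :
    M ⊗[k] N →ₗ[k] (M ⊗[k] N) ⊗[k] C :=
  (TensorProduct.assoc k M N C).symm.toLinearMap ∘ₗ b.lTensor M

theorem actL_map (f : M →ₗ[k] M') (g : N →ₗ[k] N') {a : M →ₗ[k] M ⊗[k] C}
    {a' : M' →ₗ[k] M' ⊗[k] C} (h : f.rTensor C ∘ₗ a = a' ∘ₗ f) :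
    (TensorProduct.map f g).rTensor C ∘ₗ actL a N = actL a' N' ∘ₗ TensorProduct.map f g := by
  ext m n
  have h' := LinearMap.congr_fun h m
  simp only [LinearMap.comp_apply] at h'
  simp only [actL, TensorProduct.AlgebraTensorModule.curry_apply, LinearMap.restrictScalars_self,
    TensorProduct.curry_apply, LinearMap.comp_apply, LinearMap.rTensor_tmul,
    TensorProduct.map_tmul, ← h', LinearEquiv.coe_coe]
  induction a m using TensorProduct.induction_on with
  | zero => simp
  | tmul x c => simp
  | add x y hx hy => simp only [TensorProduct.add_tmul, map_add, hx, hy]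

theorem actR_map (f : M →ₗ[k] M') (g : N →ₗ[k] N') {b : N →ₗ[k] N ⊗[k] C}
    {b' : N' →ₗ[k] N' ⊗[k] C} (h : g.rTensor C ∘ₗ b = b' ∘ₗ g) :
    (TensorProduct.map f g).rTensor C ∘ₗ actR M b = actR M' b' ∘ₗ TensorProduct.map f g := by
  ext m n
  have h' := LinearMap.congr_fun h n
  simp only [LinearMap.comp_apply] at h'
  simp only [actR, TensorProduct.AlgebraTensorModule.curry_apply, LinearMap.restrictScalars_self,
    TensorProduct.curry_apply, LinearMap.comp_apply, LinearMap.lTensor_tmul,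
    TensorProduct.map_tmul, ← h', LinearEquiv.coe_coe]
  induction b n using TensorProduct.induction_on with
  | zero => simp
  | tmul x c => simp
  | add x y hx hy => simp only [TensorProduct.tmul_add, map_add, hx, hy]

theorem actL_comm (a : M →ₗ[k] M ⊗[k] C) :
    (TensorProduct.comm k M N).toLinearMap.rTensor C ∘ₗ actL a N =
      actR N a ∘ₗ (TensorProduct.comm k M N).toLinearMap := by
  ext m n
  simp only [actL, actR, TensorProduct.AlgebraTensorModule.curry_apply,
    LinearMap.restrictScalars_self, TensorProduct.curry_apply, LinearMap.comp_apply,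
    LinearMap.rTensor_tmul, LinearEquiv.coe_coe, TensorProduct.comm_tmul, LinearMap.lTensor_tmul]
  induction a m using TensorProduct.induction_on with
  | zero => simp
  | tmul x c => simp
  | add x y hx hy => simp only [TensorProduct.add_tmul, TensorProduct.tmul_add, map_add, hx, hy]

theorem actR_comm (b : N →ₗ[k] N ⊗[k] C) :
    (TensorProduct.comm k M N).toLinearMap.rTensor C ∘ₗ actR M b =
      actL b M ∘ₗ (TensorProduct.comm k M N).toLinearMap := by
  ext m n
  simp only [actL, actR, TensorProduct.AlgebraTensorModule.curry_apply,
    LinearMap.restrictScalars_self, TensorProduct.curry_apply, LinearMap.comp_apply,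
    LinearMap.rTensor_tmul, LinearEquiv.coe_coe, TensorProduct.comm_tmul, LinearMap.lTensor_tmul]
  induction b n using TensorProduct.induction_on with
  | zero => simp
  | tmul x c => simp
  | add x y hx hy => simp only [TensorProduct.add_tmul, TensorProduct.tmul_add, map_add, hx, hy]

theorem assoc_actL_actL (a : M →ₗ[k] M ⊗[k] C) :
    (TensorProduct.assoc k M N P).toLinearMap.rTensor C ∘ₗ actL (actL a N) P =
      actL a (N ⊗[k] P) ∘ₗ (TensorProduct.assoc k M N P).toLinearMap := by
  ext m n p
  simp only [actL, TensorProduct.AlgebraTensorModule.curry_apply,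
    LinearMap.restrictScalars_self, TensorProduct.curry_apply, LinearMap.comp_apply,
    LinearMap.rTensor_tmul, LinearEquiv.coe_coe, TensorProduct.assoc_tmul]
  induction a m using TensorProduct.induction_on with
  | zero => simp
  | tmul x c => simp
  | add x y hx hy => simp only [TensorProduct.add_tmul, map_add, hx, hy]

theorem assoc_actL_actR (b : N →ₗ[k] N ⊗[k] C) :
    (TensorProduct.assoc k M N P).toLinearMap.rTensor C ∘ₗ actL (actR M b) P =
      actR M (actL b P) ∘ₗ (TensorProduct.assoc k M N P).toLinearMap := by
  ext m n p
  simp only [actL, actR, TensorProduct.AlgebraTensorModule.curry_apply,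
    LinearMap.restrictScalars_self, TensorProduct.curry_apply, LinearMap.comp_apply,
    LinearMap.rTensor_tmul, LinearMap.lTensor_tmul, LinearEquiv.coe_coe, TensorProduct.assoc_tmul]
  induction b n using TensorProduct.induction_on with
  | zero => simp
  | tmul x c => simp
  | add x y hx hy => simp only [TensorProduct.add_tmul, TensorProduct.tmul_add, map_add, hx, hy]

theorem assoc_actR (c : P →ₗ[k] P ⊗[k] C) :
    (TensorProduct.assoc k M N P).toLinearMap.rTensor C ∘ₗ actR (M ⊗[k] N) c =
      actR M (actR N c) ∘ₗ (TensorProduct.assoc k M N P).toLinearMap := by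
  ext m n p
  simp only [actR, TensorProduct.AlgebraTensorModule.curry_apply,
    LinearMap.restrictScalars_self, TensorProduct.curry_apply, LinearMap.comp_apply,
    LinearMap.lTensor_tmul, LinearEquiv.coe_coe, TensorProduct.assoc_tmul]
  induction c p using TensorProduct.induction_on with
  | zero => simp
  | tmul x c => simp
  | add x y hx hy => simp only [TensorProduct.tmul_add, map_add, hx, hy]

theorem actL_actR_comm (a : M →ₗ[k] M ⊗[k] C) (b : N →ₗ[k] N ⊗[k] C) :
    (actL a N).rTensor C ∘ₗ actR M b =
      (TensorProduct.rightComm k (M ⊗[k] N) C C).toLinearMap ∘ₗ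
        (actR M b).rTensor C ∘ₗ actL a N := by
  ext m n
  simp only [actL, actR, TensorProduct.AlgebraTensorModule.curry_apply,
    LinearMap.restrictScalars_self, TensorProduct.curry_apply, LinearMap.comp_apply,
    LinearMap.rTensor_tmul, LinearMap.lTensor_tmul, LinearEquiv.coe_coe]
  have key : ∀ (s : M ⊗[k] C) (t : N ⊗[k] C), a m = s → b n = t →
      ((TensorProduct.rightComm k M C N).toLinearMap ∘ₗ a.rTensor N).rTensor C
        ((TensorProduct.assoc k M N C).symm (m ⊗ₜ t)) =
      (TensorProduct.rightComm k (M ⊗[k] N) C C)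
        (((TensorProduct.assoc k M N C).symm.toLinearMap ∘ₗ b.lTensor M).rTensor C
          (TensorProduct.rightComm k M C N (s ⊗ₜ n))) := by
    intro s t hs ht
    have h1 : ∀ t : N ⊗[k] C,
        ((TensorProduct.rightComm k M C N).toLinearMap ∘ₗ a.rTensor N).rTensor C
          ((TensorProduct.assoc k M N C).symm (m ⊗ₜ t)) =
        (TensorProduct.rightComm k M C N).toLinearMap.rTensor C
          ((TensorProduct.assoc k (M ⊗[k] C) N C).symm (s ⊗ₜ t)) := by
      intro t
      induction t using TensorProduct.induction_on with
      | zero => simp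
      | tmul x c => simp [hs]
      | add x y hx hy => simp only [TensorProduct.tmul_add, map_add, hx, hy]
    have h2 : ∀ s : M ⊗[k] C,
        (((TensorProduct.assoc k M N C).symm.toLinearMap ∘ₗ b.lTensor M).rTensor C
          (TensorProduct.rightComm k M C N (s ⊗ₜ n))) =
        (TensorProduct.assoc k M N C).symm.toLinearMap.rTensor C
          (TensorProduct.rightComm k M C (N ⊗[k] C) (s ⊗ₜ t)) := by
      intro s
      induction s using TensorProduct.induction_on with
      | zero => simp
      | tmul x c => simp [ht]
      | add x y hx hy => simp only [TensorProduct.add_tmul, map_add, hx, hy]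
    rw [h1, h2]
    clear h1 h2 hs ht
    induction s using TensorProduct.induction_on with
    | zero => simp
    | add x y hx hy => simp only [TensorProduct.add_tmul, map_add, hx, hy]
    | tmul x c =>
      induction t using TensorProduct.induction_on with
      | zero => simp
      | tmul x c => simp
      | add x y hx hy => simp only [TensorProduct.tmul_add, map_add, hx, hy]
  exact key _ _ rfl rfl

theorem rTensor_inj {j : A →ₗ[k] B} (hj : Function.Injective j) (P : Type u) [AddCommGroup P]
    [Module k P] : Function.Injective (j.rTensor P) :=
  Module.Flat.rTensor_preserves_injective_linearMap j hj

theorem lTensor_inj {j : A →ₗ[k] B} (hj : Function.Injective j) (P : Type u) [AddCommGroup P]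
    [Module k P] : Function.Injective (j.lTensor P) :=
  Module.Flat.lTensor_preserves_injective_linearMap j hj

theorem mem_range_lTensor {K : Submodule k M} {f g : M →ₗ[k] N} (hK : K = LinearMap.eqLocus f g)
    (z : P ⊗[k] M) (hz : f.lTensor P z = g.lTensor P z) :
    z ∈ LinearMap.range (K.subtype.lTensor P) := by
  subst hK
  have h := Module.Flat.eqLocus_lTensor_eq (R := k) (S := k) (M := P) f g
  have : z ∈ LinearMap.eqLocus (TensorProduct.AlgebraTensorModule.lTensor k P f)
      (TensorProduct.AlgebraTensorModule.lTensor k P g) := hz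
  rw [h] at this
  exact this

theorem comm_rTensor (f : M →ₗ[k] N) (z : M ⊗[k] P) :
    TensorProduct.comm k N P (f.rTensor P z) = f.lTensor P (TensorProduct.comm k M P z) := by
  induction z using TensorProduct.induction_on with
  | zero => simp
  | tmul x c => simp
  | add x y hx hy => simp only [map_add, hx, hy]

theorem mem_range_rTensor {K : Submodule k M} {f g : M →ₗ[k] N} (hK : K = LinearMap.eqLocus f g)
    (z : M ⊗[k] P) (hz : f.rTensor P z = g.rTensor P z) :
    z ∈ LinearMap.range (K.subtype.rTensor P) := by
  obtain ⟨y, hy⟩ := mem_range_lTensor (P := P) hK (TensorProduct.comm k M P z) (by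
    rw [← comm_rTensor, ← comm_rTensor, hz])
  refine ⟨(TensorProduct.comm k K P).symm y, ?_⟩
  apply (TensorProduct.comm k M P).injective
  rw [← hy, comm_rTensor, LinearEquiv.apply_symm_apply]

/-- Factor a linear map through an injective one. -/
noncomputable def liftInj {A B Z : Type u} [AddCommMonoid A] [Module k A] [AddCommMonoid B]
    [Module k B] [AddCommMonoid Z] [Module k Z] (j : A →ₗ[k] B) (hj : Function.Injective j)
    (f : Z →ₗ[k] B) (h : ∀ z, f z ∈ LinearMap.range j) : Z →ₗ[k] A :=
  (LinearEquiv.ofInjective j hj).symm.toLinearMap ∘ₗ f.codRestrict (LinearMap.range j) h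

theorem comp_liftInj {A B Z : Type u} [AddCommMonoid A] [Module k A] [AddCommMonoid B]
    [Module k B] [AddCommMonoid Z] [Module k Z] (j : A →ₗ[k] B) (hj : Function.Injective j)
    (f : Z →ₗ[k] B) (h : ∀ z, f z ∈ LinearMap.range j) : j ∘ₗ liftInj j hj f h = f := by
  ext z
  simp [liftInj]

end Linear

section Coalgebraic

variable {k : Type u} [Field k] {C : Type u} [AddCommGroup C] [Module k C] [Coalgebra k C]
variable {M N : Type u} [AddCommGroup M] [Module k M] [AddCommGroup N] [Module k N]

/-- The coassociativity law of a coaction. -/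
def IsCoassoc (a : M →ₗ[k] M ⊗[k] C) : Prop :=
  (TensorProduct.assoc k M C C).toLinearMap ∘ₗ a.rTensor C ∘ₗ a =
    (Coalgebra.comul (R := k) (A := C)).lTensor M ∘ₗ a

/-- The counit law of a coaction. -/
def IsCounital (a : M →ₗ[k] M ⊗[k] C) : Prop :=
  (Coalgebra.counit (R := k) (A := C)).lTensor M ∘ₗ a = (TensorProduct.mk k M k).flip 1

theorem isCoassoc_actR {b : N →ₗ[k] N ⊗[k] C} (hb : IsCoassoc b) : IsCoassoc (actR M b) := by
  ext m n
  have h := LinearMap.congr_fun hb n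
  simp only [LinearMap.comp_apply, LinearEquiv.coe_coe] at h
  simp only [actR, TensorProduct.AlgebraTensorModule.curry_apply,
    LinearMap.restrictScalars_self, TensorProduct.curry_apply, LinearMap.comp_apply,
    LinearMap.lTensor_tmul, LinearEquiv.coe_coe]
  have h1 : ∀ t : N ⊗[k] C, TensorProduct.assoc k (M ⊗[k] N) C C
      (((TensorProduct.assoc k M N C).symm.toLinearMap ∘ₗ b.lTensor M).rTensor C
        ((TensorProduct.assoc k M N C).symm (m ⊗ₜ t))) =
      (TensorProduct.assoc k M N (C ⊗[k] C)).symm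
        (m ⊗ₜ (TensorProduct.assoc k N C C (b.rTensor C t))) := by
    intro t
    induction t using TensorProduct.induction_on with
    | zero => simp
    | add x y hx hy => simp only [TensorProduct.tmul_add, map_add, hx, hy]
    | tmul x c =>
      simp only [TensorProduct.assoc_symm_tmul, LinearMap.rTensor_tmul, LinearMap.comp_apply,
        LinearMap.lTensor_tmul, LinearEquiv.coe_coe]
      induction b x using TensorProduct.induction_on with
      | zero => simp
      | add x y hx hy => simp only [TensorProduct.tmul_add, TensorProduct.add_tmul, map_add, hx, hy]
      | tmul x c => simp
  rw [h1, h]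
  induction b n using TensorProduct.induction_on with
  | zero => simp
  | add x y hx hy => simp only [TensorProduct.tmul_add, map_add, hx, hy]
  | tmul x c =>
    simp only [TensorProduct.assoc_symm_tmul, LinearMap.lTensor_tmul]

theorem isCounital_actR {b : N →ₗ[k] N ⊗[k] C} (hb : IsCounital b) : IsCounital (actR M b) := by
  ext m n
  have h := LinearMap.congr_fun hb n
  simp only [LinearMap.comp_apply, LinearMap.flip_apply, TensorProduct.mk_apply] at h
  simp only [actR, TensorProduct.AlgebraTensorModule.curry_apply,
    LinearMap.restrictScalars_self, TensorProduct.curry_apply, LinearMap.comp_apply,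
    LinearMap.lTensor_tmul, LinearEquiv.coe_coe, LinearMap.flip_apply, TensorProduct.mk_apply]
  have h1 : ∀ t : N ⊗[k] C, (Coalgebra.counit (R := k) (A := C)).lTensor (M ⊗[k] N)
        ((TensorProduct.assoc k M N C).symm (m ⊗ₜ t)) =
      (TensorProduct.assoc k M N k).symm
        (m ⊗ₜ ((Coalgebra.counit (R := k) (A := C)).lTensor N t)) := by
    intro t
    induction t using TensorProduct.induction_on with
    | zero => simp
    | add x y hx hy => simp only [TensorProduct.tmul_add, map_add, hx, hy]
    | tmul x c => simp
  rw [h1, h, TensorProduct.assoc_symm_tmul]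

/-- On a space with two commuting coactions of a cocommutative coalgebra, the second coaction
maps the equalizer `K` of both into `K ⊗ C`. -/
theorem act_mem_range [Coalgebra.IsCocomm k C] {a b : M →ₗ[k] M ⊗[k] C} (hb : IsCoassoc b)
    (hab : a.rTensor C ∘ₗ b =
      (TensorProduct.rightComm k M C C).toLinearMap ∘ₗ b.rTensor C ∘ₗ a)
    {K : Submodule k M} (hK : K = LinearMap.eqLocus a b) {t : M} (ht : t ∈ K) :
    b t ∈ LinearMap.range (K.subtype.rTensor C) := by
  apply mem_range_rTensor hK
  have h1 := LinearMap.congr_fun hab t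
  have h2 := LinearMap.congr_fun hb t
  have h3 : a t = b t := by rw [hK] at ht; exact ht
  simp only [LinearMap.comp_apply, LinearEquiv.coe_coe] at h1 h2
  rw [h1, h3]
  apply (TensorProduct.assoc k M C C).injective
  have h4 : ∀ z : (M ⊗[k] C) ⊗[k] C, TensorProduct.assoc k M C C
      (TensorProduct.rightComm k M C C z) =
      (TensorProduct.comm k C C).toLinearMap.lTensor M (TensorProduct.assoc k M C C z) := by
    intro z
    have : (TensorProduct.assoc k M C C).toLinearMap ∘ₗ
        (TensorProduct.rightComm k M C C).toLinearMap =
      (TensorProduct.comm k C C).toLinearMap.lTensor M ∘ₗ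
        (TensorProduct.assoc k M C C).toLinearMap := by
      ext; simp
    exact LinearMap.congr_fun this z
  rw [h4, h2, ← LinearMap.comp_apply, ← LinearMap.lTensor_comp]
  congr 2
  exact Coalgebra.comm_comp_comul k C

end Coalgebraic


/-- Comodules over the `k`-coalgebra `C`. -/
structure Comod (k : Type u) [Field k] (C : Type u) [AddCommGroup C] [Module k C]
    [Coalgebra k C] where
  /-- the underlying vector space -/
  carrier : Type u
  [addCommGroup : AddCommGroup carrier]
  [module : Module k carrier]
  /-- the coaction -/
  coact : carrier →ₗ[k] carrier ⊗[k] C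
  coassoc : IsCoassoc coact
  counital : IsCounital coact

attribute [instance] Comod.addCommGroup Comod.module

namespace Comod

variable {k : Type u} [Field k] {C : Type u} [AddCommGroup C] [Module k C] [Coalgebra k C]

instance : CoeSort (Comod k C) (Type u) := ⟨Comod.carrier⟩

/-- Morphisms of comodules. -/
@[ext]
structure Hom (V W : Comod k C) where
  /-- the underlying linear map -/
  lin : V →ₗ[k] W
  colinear : lin.rTensor C ∘ₗ V.coact = W.coact ∘ₗ lin

/-- The category `Vec^C` of `C`-comodules. -/
instance : Category (Comod k C) where
  Hom V W := Hom V W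
  id V := ⟨LinearMap.id, by simp⟩
  comp f g := ⟨g.lin ∘ₗ f.lin, by
    rw [LinearMap.rTensor_comp, LinearMap.comp_assoc, f.colinear, ← LinearMap.comp_assoc,
      g.colinear, LinearMap.comp_assoc]⟩

@[simp] theorem id_lin (V : Comod k C) : Hom.lin (𝟙 V) = LinearMap.id := rfl

@[simp] theorem comp_lin {V W X : Comod k C} (f : V ⟶ W) (g : W ⟶ X) :
    Hom.lin (f ≫ g) = g.lin ∘ₗ f.lin := rfl

@[ext] theorem hom_ext {V W : Comod k C} {f g : V ⟶ W} (h : f.lin = g.lin) : f = g := Hom.ext h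

/-- The underlying space of the cotensor product `V ⊗^C W`: the equalizer of
`v ⊗ id` and `id ⊗ τ w` from `V ⊗ W` to `V ⊗ C ⊗ W`. -/
noncomputable def cotensorSpace (V W : Comod k C) : Submodule k (V ⊗[k] W) :=
  LinearMap.eqLocus
    ((TensorProduct.assoc k V C W).toLinearMap ∘ₗ V.coact.rTensor W)
    (((TensorProduct.comm k W C).toLinearMap ∘ₗ W.coact).lTensor V)

theorem cotensorSpace_eq (V W : Comod k C) :
    cotensorSpace V W = LinearMap.eqLocus (actL V.coact W) (actR V W.coact) := by
  let e : V ⊗[k] (C ⊗[k] W) ≃ₗ[k] (V ⊗[k] W) ⊗[k] C :=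
    TensorProduct.congr (LinearEquiv.refl k V) (TensorProduct.comm k C W) ≪≫ₗ
      (TensorProduct.assoc k V W C).symm
  have h1 : e.toLinearMap ∘ₗ ((TensorProduct.assoc k V C W).toLinearMap ∘ₗ V.coact.rTensor W) =
      actL V.coact W := by
    rw [actL, ← LinearMap.comp_assoc]
    congr 1
    ext
    simp [e]
  have h2 : e.toLinearMap ∘ₗ (((TensorProduct.comm k W C).toLinearMap ∘ₗ W.coact).lTensor V) =
      actR V W.coact := by
    rw [actR, LinearMap.lTensor_comp, ← LinearMap.comp_assoc]
    congr 1
    ext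
    simp [e]
  rw [← h1, ← h2]
  ext t
  exact e.injective.eq_iff.symm

/-- The inclusion of `V ⊗^C W` in `V ⊗ W`. -/
noncomputable abbrev inc (V W : Comod k C) : cotensorSpace V W →ₗ[k] V ⊗[k] W :=
  (cotensorSpace V W).subtype

theorem inc_injective (V W : Comod k C) : Function.Injective (inc V W) :=
  Subtype.val_injective

theorem actL_inc (V W : Comod k C) :
    actL V.coact W ∘ₗ inc V W = actR V W.coact ∘ₗ inc V W := by
  ext t
  have : (t : V ⊗[k] W) ∈ LinearMap.eqLocus (actL V.coact W) (actR V W.coact) :=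
    cotensorSpace_eq V W ▸ t.2
  exact this

/-- A map which embeds in a coassociative, counital one is such. -/
theorem isCoassoc_of_inj {A B : Type u} [AddCommGroup A] [Module k A] [AddCommGroup B]
    [Module k B] {j : A →ₗ[k] B} (hj : Function.Injective j) {a : A →ₗ[k] A ⊗[k] C}
    {b : B →ₗ[k] B ⊗[k] C} (h : j.rTensor C ∘ₗ a = b ∘ₗ j) (hb : IsCoassoc b) : IsCoassoc a := by
  apply LinearMap.ext
  intro x
  apply rTensor_inj hj (C ⊗[k] C)
  have e0 : ∀ x, j.rTensor C (a x) = b (j x) := LinearMap.congr_fun h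
  have e1 : ∀ z : (A ⊗[k] C) ⊗[k] C, j.rTensor (C ⊗[k] C) (TensorProduct.assoc k A C C z) =
      TensorProduct.assoc k B C C ((j.rTensor C).rTensor C z) := by
    intro z
    have : j.rTensor (C ⊗[k] C) ∘ₗ (TensorProduct.assoc k A C C).toLinearMap =
      (TensorProduct.assoc k B C C).toLinearMap ∘ₗ (j.rTensor C).rTensor C := by
      ext; simp
    exact LinearMap.congr_fun this z
  have e2 : ∀ z : A ⊗[k] C, (j.rTensor C).rTensor C (a.rTensor C z) =
      b.rTensor C (j.rTensor C z) := by
    intro z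
    rw [← LinearMap.comp_apply, ← LinearMap.rTensor_comp, h, LinearMap.rTensor_comp,
      LinearMap.comp_apply]
  have e3 : ∀ z : A ⊗[k] C, j.rTensor (C ⊗[k] C)
      ((Coalgebra.comul (R := k) (A := C)).lTensor A z) =
      (Coalgebra.comul (R := k) (A := C)).lTensor B (j.rTensor C z) := by
    intro z
    rw [← LinearMap.comp_apply, ← LinearMap.comp_apply, LinearMap.rTensor_comp_lTensor,
      LinearMap.lTensor_comp_rTensor]
  simp only [LinearMap.comp_apply, LinearEquiv.coe_coe]
  rw [e1, e2, e3, e0]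
  exact LinearMap.congr_fun hb (j x)

theorem isCounital_of_inj {A B : Type u} [AddCommGroup A] [Module k A] [AddCommGroup B]
    [Module k B] {j : A →ₗ[k] B} (hj : Function.Injective j) {a : A →ₗ[k] A ⊗[k] C}
    {b : B →ₗ[k] B ⊗[k] C} (h : j.rTensor C ∘ₗ a = b ∘ₗ j) (hb : IsCounital b) :
    IsCounital a := by
  apply LinearMap.ext
  intro x
  apply rTensor_inj hj k
  have e0 : ∀ x, j.rTensor C (a x) = b (j x) := LinearMap.congr_fun h
  have e3 : ∀ z : A ⊗[k] C, j.rTensor k ((Coalgebra.counit (R := k) (A := C)).lTensor A z) =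
      (Coalgebra.counit (R := k) (A := C)).lTensor B (j.rTensor C z) := by
    intro z
    rw [← LinearMap.comp_apply, ← LinearMap.comp_apply, LinearMap.rTensor_comp_lTensor,
      LinearMap.lTensor_comp_rTensor]
  rw [LinearMap.comp_apply, e3, e0]
  simpa using LinearMap.congr_fun hb (j x)

variable (k C) in
/-- `C` as a comodule over itself. -/
noncomputable def unit : Comod k C where
  carrier := C
  coact := Coalgebra.comul
  coassoc := Coalgebra.coassoc
  counital := Coalgebra.lTensor_counit_comp_comul

/-- `id ⊗ ε : V ⊗ C → V`. -/
noncomputable def evC (V : Comod k C) : V ⊗[k] C →ₗ[k] V :=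
  (TensorProduct.rid k V).toLinearMap ∘ₗ (Coalgebra.counit (R := k) (A := C)).lTensor V

theorem evC_coact (V : Comod k C) : evC V ∘ₗ V.coact = LinearMap.id := by
  rw [evC, LinearMap.comp_assoc, V.counital]
  ext
  simp

theorem evC_actL (V : Comod k C) : (evC V).rTensor C ∘ₗ actL V.coact C = V.coact ∘ₗ evC V := by
  have h := actL_map (LinearMap.id (M := V)) (Coalgebra.counit (R := k) (A := C))
    (a := V.coact) (a' := V.coact) (by simp)
  have h' : (TensorProduct.rid k V).toLinearMap.rTensor C ∘ₗ actL V.coact k =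
      V.coact ∘ₗ (TensorProduct.rid k V).toLinearMap := by
    ext v
    simp only [actL, TensorProduct.AlgebraTensorModule.curry_apply,
      LinearMap.restrictScalars_self, TensorProduct.curry_apply, LinearMap.comp_apply,
      LinearMap.rTensor_tmul, LinearEquiv.coe_coe, TensorProduct.rid_tmul, one_smul]
    induction V.coact v using TensorProduct.induction_on with
    | zero => simp
    | tmul x c => simp
    | add x y hx hy => simp only [TensorProduct.add_tmul, map_add, hx, hy]
  rw [evC, LinearMap.rTensor_comp, LinearMap.comp_assoc]
  erw [h]
  rw [← LinearMap.comp_assoc, h', LinearMap.comp_assoc]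
  rfl

theorem evC_actR (V : Comod k C) :
    (evC V).rTensor C ∘ₗ actR V (Coalgebra.comul (R := k) (A := C)) = LinearMap.id := by
  ext v c
  have h := Coalgebra.rTensor_counit_comul (R := k) c
  simp only [actR, TensorProduct.AlgebraTensorModule.curry_apply,
      LinearMap.restrictScalars_self, TensorProduct.curry_apply, LinearMap.comp_apply,
      LinearMap.lTensor_tmul, LinearEquiv.coe_coe, LinearMap.id_apply]
  have h1 : ∀ z : C ⊗[k] C, (evC V).rTensor C ((TensorProduct.assoc k V C C).symm (v ⊗ₜ z)) =
      v ⊗ₜ[k] TensorProduct.lid k C ((Coalgebra.counit (R := k) (A := C)).rTensor C z) := by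
    intro z
    induction z using TensorProduct.induction_on with
    | zero => simp
    | tmul x c => simp [evC, TensorProduct.smul_tmul]
    | add x y hx hy => simp only [TensorProduct.tmul_add, map_add, hx, hy]
  rw [h1, h]
  simp

theorem coact_actR (V : Comod k C) : V.coact.rTensor C ∘ₗ V.coact =
    actR V (Coalgebra.comul (R := k) (A := C)) ∘ₗ V.coact := by
  rw [actR, LinearMap.comp_assoc, ← V.coassoc, ← LinearMap.comp_assoc,
    LinearEquiv.symm_comp, LinearMap.id_comp]

theorem comp_cancel {A B Z : Type u} [AddCommMonoid A] [Module k A] [AddCommMonoid B]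
    [Module k B] [AddCommMonoid Z] [Module k Z] {j : A →ₗ[k] B} (hj : Function.Injective j)
    {f g : Z →ₗ[k] A} (h : j ∘ₗ f = j ∘ₗ g) : f = g :=
  LinearMap.ext fun x => hj (LinearMap.congr_fun h x)

theorem comp_cancel_right {A B Z : Type u} [AddCommMonoid A] [Module k A] [AddCommMonoid B]
    [Module k B] [AddCommMonoid Z] [Module k Z] {p : A →ₗ[k] B} (hp : Function.Surjective p)
    {f g : B →ₗ[k] Z} (h : f ∘ₗ p = g ∘ₗ p) : f = g :=
  (LinearMap.cancel_right hp).1 h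

variable [Coalgebra.IsCocomm k C]

theorem actR_mem_range (V W : Comod k C) (t : cotensorSpace V W) :
    (actR V W.coact ∘ₗ inc V W) t ∈ LinearMap.range ((inc V W).rTensor C) :=
  act_mem_range (a := actL V.coact W) (b := actR V W.coact) (isCoassoc_actR W.coassoc)
    (actL_actR_comm _ _) (cotensorSpace_eq V W) t.2

/-- The coaction on `V ⊗^C W`, induced by `id ⊗ w`. -/
noncomputable def cotensorCoact (V W : Comod k C) :
    cotensorSpace V W →ₗ[k] cotensorSpace V W ⊗[k] C :=
  liftInj ((inc V W).rTensor C) (rTensor_inj (inc_injective V W) C)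
    (actR V W.coact ∘ₗ inc V W) (actR_mem_range V W)

theorem inc_cotensorCoact (V W : Comod k C) :
    (inc V W).rTensor C ∘ₗ cotensorCoact V W = actR V W.coact ∘ₗ inc V W :=
  comp_liftInj _ _ _ _

/-- The cotensor product `V ⊗^C W`. -/
noncomputable def cotensor (V W : Comod k C) : Comod k C where
  carrier := cotensorSpace V W
  coact := cotensorCoact V W
  coassoc := isCoassoc_of_inj (inc_injective V W) (inc_cotensorCoact V W)
    (isCoassoc_actR W.coassoc)
  counital := isCounital_of_inj (inc_injective V W) (inc_cotensorCoact V W)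
    (isCounital_actR W.counital)

/-- The inclusion of `V ⊗^C W` in `V ⊗ W`. -/
noncomputable def incl (V W : Comod k C) : cotensor V W →ₗ[k] V ⊗[k] W := inc V W

theorem incl_injective (V W : Comod k C) : Function.Injective (incl V W) :=
  Subtype.val_injective

theorem incl_coact (V W : Comod k C) :
    (incl V W).rTensor C ∘ₗ (cotensor V W).coact = actR V W.coact ∘ₗ incl V W :=
  inc_cotensorCoact V W

theorem incl_coact' (V W : Comod k C) :
    (incl V W).rTensor C ∘ₗ (cotensor V W).coact = actL V.coact W ∘ₗ incl V W :=
  (inc_cotensorCoact V W).trans (actL_inc V W).symm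

theorem hom_ext_incl {Z V W : Comod k C} {f g : Z ⟶ cotensor V W}
    (h : incl V W ∘ₗ f.lin = incl V W ∘ₗ g.lin) : f = g :=
  hom_ext (LinearMap.ext fun x => incl_injective V W (LinearMap.congr_fun h x))

/-- The linear map to `V ⊗^C W` induced by one to `V ⊗ W`. -/
noncomputable def liftLin {Z V W : Comod k C} (f : Z →ₗ[k] V ⊗[k] W)
    (h : actL V.coact W ∘ₗ f = actR V W.coact ∘ₗ f) : Z →ₗ[k] cotensor V W :=
  f.codRestrict (cotensorSpace V W) (fun z => by
    rw [cotensorSpace_eq, LinearMap.mem_eqLocus]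
    exact LinearMap.congr_fun h z)

theorem incl_liftLin {Z V W : Comod k C} (f : Z →ₗ[k] V ⊗[k] W)
    (h : actL V.coact W ∘ₗ f = actR V W.coact ∘ₗ f) : incl V W ∘ₗ liftLin f h = f := rfl

/-- A linear map to `V ⊗ W` which is colinear for both coactions gives a morphism to
`V ⊗^C W`. -/
noncomputable def lift {Z V W : Comod k C} (f : Z →ₗ[k] V ⊗[k] W)
    (hL : f.rTensor C ∘ₗ Z.coact = actL V.coact W ∘ₗ f)
    (hR : f.rTensor C ∘ₗ Z.coact = actR V W.coact ∘ₗ f) : Z ⟶ cotensor V W where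
  lin := liftLin f (hL.symm.trans hR)
  colinear := by
    apply LinearMap.ext
    intro z
    apply rTensor_inj (incl_injective V W) C
    have h1 : (incl V W).rTensor C ∘ₗ (liftLin f (hL.symm.trans hR)).rTensor C ∘ₗ Z.coact =
        (incl V W).rTensor C ∘ₗ (cotensor V W).coact ∘ₗ liftLin f (hL.symm.trans hR) := by
      rw [← LinearMap.comp_assoc, ← LinearMap.comp_assoc, ← LinearMap.rTensor_comp, incl_coact,
        LinearMap.comp_assoc, incl_liftLin, hR]
    exact LinearMap.congr_fun h1 z

theorem incl_lift {Z V W : Comod k C} (f : Z →ₗ[k] V ⊗[k] W)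
    (hL : f.rTensor C ∘ₗ Z.coact = actL V.coact W ∘ₗ f)
    (hR : f.rTensor C ∘ₗ Z.coact = actR V W.coact ∘ₗ f) :
    incl V W ∘ₗ (lift f hL hR).lin = f := rfl

/-- The cotensor product of morphisms, the restriction of `f ⊗ g`. -/
noncomputable def cotensorHom {V V' W W' : Comod k C} (f : V ⟶ V') (g : W ⟶ W') :
    cotensor V W ⟶ cotensor V' W' :=
  lift (TensorProduct.map f.lin g.lin ∘ₗ incl V W)
    (by rw [LinearMap.rTensor_comp, LinearMap.comp_assoc, incl_coact', ← LinearMap.comp_assoc,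
      actL_map _ _ f.colinear, LinearMap.comp_assoc])
    (by rw [LinearMap.rTensor_comp, LinearMap.comp_assoc, incl_coact, ← LinearMap.comp_assoc,
      actR_map _ _ g.colinear, LinearMap.comp_assoc])

theorem incl_cotensorHom {V V' W W' : Comod k C} (f : V ⟶ V') (g : W ⟶ W') :
    incl V' W' ∘ₗ (cotensorHom f g).lin = TensorProduct.map f.lin g.lin ∘ₗ incl V W := rfl

/-- The symmetry of the cotensor product, the restriction of `τ`. -/
noncomputable def braidHom (V W : Comod k C) : cotensor V W ⟶ cotensor W V :=
  lift ((TensorProduct.comm k V W).toLinearMap ∘ₗ incl V W)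
    (by rw [LinearMap.rTensor_comp, LinearMap.comp_assoc, incl_coact, ← LinearMap.comp_assoc,
      actR_comm, LinearMap.comp_assoc])
    (by rw [LinearMap.rTensor_comp, LinearMap.comp_assoc, incl_coact', ← LinearMap.comp_assoc,
      actL_comm, LinearMap.comp_assoc])

theorem incl_braidHom (V W : Comod k C) : incl W V ∘ₗ (braidHom V W).lin =
    (TensorProduct.comm k V W).toLinearMap ∘ₗ incl V W := rfl

theorem braidHom_braidHom (V W : Comod k C) : braidHom V W ≫ braidHom W V = 𝟙 _ := by
  apply hom_ext_incl
  rw [comp_lin, ← LinearMap.comp_assoc, incl_braidHom, LinearMap.comp_assoc, incl_braidHom,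
    ← LinearMap.comp_assoc]
  ext t
  simp

/-- The embedding of `(V ⊗^C W) ⊗^C X` in `V ⊗ (W ⊗ X)`. -/
noncomputable def embL (V W X : Comod k C) :
    cotensor (cotensor V W) X →ₗ[k] V ⊗[k] (W ⊗[k] X) :=
  (TensorProduct.assoc k V W X).toLinearMap ∘ₗ (incl V W).rTensor X ∘ₗ incl (cotensor V W) X

/-- The embedding of `V ⊗^C (W ⊗^C X)` in `V ⊗ (W ⊗ X)`. -/
noncomputable def embR (V W X : Comod k C) :
    cotensor V (cotensor W X) →ₗ[k] V ⊗[k] (W ⊗[k] X) :=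
  (incl W X).lTensor V ∘ₗ incl V (cotensor W X)

theorem embR_injective (V W X : Comod k C) : Function.Injective (embR V W X) :=
  (lTensor_inj (incl_injective W X) V).comp (incl_injective V (cotensor W X))

theorem embL_injective (V W X : Comod k C) : Function.Injective (embL V W X) :=
  (TensorProduct.assoc k V W X).injective.comp
    ((rTensor_inj (incl_injective V W) X).comp (incl_injective (cotensor V W) X))

theorem embL_coact₃ (V W X : Comod k C) :
    (embL V W X).rTensor C ∘ₗ (cotensor (cotensor V W) X).coact =
      actR V (actR W X.coact) ∘ₗ embL V W X := by
  have h := actR_map (incl V W) (LinearMap.id (M := X)) (b := X.coact) (b' := X.coact) (by simp)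
  simp only [embL, LinearMap.rTensor_comp, LinearMap.comp_assoc]
  rw [incl_coact, ← LinearMap.comp_assoc (incl (cotensor V W) X) _
    (((incl V W).rTensor X).rTensor C)]
  erw [h]
  rw [LinearMap.comp_assoc, ← LinearMap.comp_assoc _ (actR _ _), assoc_actR, LinearMap.comp_assoc]
  rfl

theorem embL_coact₂ (V W X : Comod k C) :
    (embL V W X).rTensor C ∘ₗ (cotensor (cotensor V W) X).coact =
      actR V (actL W.coact X) ∘ₗ embL V W X := by
  have h := actL_map (incl V W) (LinearMap.id (M := X)) (incl_coact V W)
  simp only [embL, LinearMap.rTensor_comp, LinearMap.comp_assoc]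
  rw [incl_coact', ← LinearMap.comp_assoc (incl (cotensor V W) X) _
    (((incl V W).rTensor X).rTensor C)]
  erw [h]
  rw [LinearMap.comp_assoc, ← LinearMap.comp_assoc _ (actL _ _), assoc_actL_actR,
    LinearMap.comp_assoc]
  rfl

theorem embL_coact₁ (V W X : Comod k C) :
    (embL V W X).rTensor C ∘ₗ (cotensor (cotensor V W) X).coact =
      actL V.coact (W ⊗[k] X) ∘ₗ embL V W X := by
  have h := actL_map (incl V W) (LinearMap.id (M := X)) (incl_coact' V W)
  simp only [embL, LinearMap.rTensor_comp, LinearMap.comp_assoc]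
  rw [incl_coact', ← LinearMap.comp_assoc (incl (cotensor V W) X) _
    (((incl V W).rTensor X).rTensor C)]
  erw [h]
  rw [LinearMap.comp_assoc, ← LinearMap.comp_assoc _ (actL _ _), assoc_actL_actL,
    LinearMap.comp_assoc]
  rfl

theorem embL_mem_range (V W X : Comod k C) (t : cotensor (cotensor V W) X) :
    embL V W X t ∈ LinearMap.range ((incl W X).lTensor V) := by
  apply mem_range_lTensor (cotensorSpace_eq W X)
  apply (TensorProduct.assoc k V (W ⊗[k] X) C).symm.injective
  exact LinearMap.congr_fun ((embL_coact₂ V W X).symm.trans (embL_coact₃ V W X)) t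

/-- `embL` with values in `V ⊗ (W ⊗^C X)`. -/
noncomputable def embM (V W X : Comod k C) :
    cotensor (cotensor V W) X →ₗ[k] V ⊗[k] cotensor W X :=
  liftInj ((incl W X).lTensor V) (lTensor_inj (incl_injective W X) V) (embL V W X)
    (embL_mem_range V W X)

theorem incl_embM (V W X : Comod k C) : (incl W X).lTensor V ∘ₗ embM V W X = embL V W X :=
  comp_liftInj _ _ _ _

/-- The associativity morphism, the restriction of that of `⊗`. -/
noncomputable def assocHom (V W X : Comod k C) :
    cotensor (cotensor V W) X ⟶ cotensor V (cotensor W X) :=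
  lift (embM V W X)
    (by
      apply comp_cancel (rTensor_inj (lTensor_inj (incl_injective W X) V) C)
      have h := actL_map (LinearMap.id (M := V)) (incl W X) (a := V.coact) (a' := V.coact) (by simp)
      rw [← LinearMap.comp_assoc, ← LinearMap.rTensor_comp, incl_embM, embL_coact₁,
        ← LinearMap.comp_assoc]
      erw [h]
      rw [LinearMap.comp_assoc]
      erw [incl_embM])
    (by
      apply comp_cancel (rTensor_inj (lTensor_inj (incl_injective W X) V) C)
      have h := actR_map (LinearMap.id (M := V)) (incl W X) (incl_coact W X)
      rw [← LinearMap.comp_assoc, ← LinearMap.rTensor_comp, incl_embM, embL_coact₃,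
        ← LinearMap.comp_assoc]
      erw [h]
      rw [LinearMap.comp_assoc]
      erw [incl_embM])

theorem embR_assocHom (V W X : Comod k C) :
    embR V W X ∘ₗ (assocHom V W X).lin = embL V W X := by
  rw [embR, LinearMap.comp_assoc, assocHom, incl_lift, incl_embM]

theorem embL_braidHom (V W X : Comod k C) :
    embL V W X ∘ₗ (braidHom X (cotensor V W)).lin =
      ((TensorProduct.assoc k V W X).toLinearMap ∘ₗ
        (TensorProduct.comm k X (V ⊗[k] W)).toLinearMap) ∘ₗ embR X V W := by
  have h : (incl V W).rTensor X ∘ₗ (TensorProduct.comm k X (cotensor V W)).toLinearMap =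
      (TensorProduct.comm k X (V ⊗[k] W)).toLinearMap ∘ₗ (incl V W).lTensor X := by
    ext; simp
  rw [embL, embR, LinearMap.comp_assoc, LinearMap.comp_assoc, incl_braidHom,
    ← LinearMap.comp_assoc (incl X (cotensor V W)), h]
  rfl

theorem embR_whisker {V V' W W' X X' : Comod k C} (f : V ⟶ V') (g : W ⟶ W') (h : X ⟶ X') :
    embR V' W' X' ∘ₗ (cotensorHom f (cotensorHom g h)).lin =
      TensorProduct.map f.lin (TensorProduct.map g.lin h.lin) ∘ₗ embR V W X := by
  rw [embR, embR, LinearMap.comp_assoc, incl_cotensorHom, ← LinearMap.comp_assoc,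
    LinearMap.lTensor_comp_map, incl_cotensorHom, ← LinearMap.comp_assoc,
    LinearMap.map_comp_lTensor]

theorem embL_whisker {V V' W W' X X' : Comod k C} (f : V ⟶ V') (g : W ⟶ W') (h : X ⟶ X') :
    embL V' W' X' ∘ₗ (cotensorHom (cotensorHom f g) h).lin =
      TensorProduct.map f.lin (TensorProduct.map g.lin h.lin) ∘ₗ embL V W X := by
  rw [embL, embL, LinearMap.comp_assoc, LinearMap.comp_assoc, incl_cotensorHom,
    ← LinearMap.comp_assoc (incl (cotensor V W) X), LinearMap.rTensor_comp_map, incl_cotensorHom,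
    ← LinearMap.map_comp_rTensor, LinearMap.comp_assoc, ← LinearMap.comp_assoc _ _
    (TensorProduct.assoc k V' W' X').toLinearMap, ← LinearMap.comp_assoc _ _
    (TensorProduct.map f.lin (TensorProduct.map g.lin h.lin)),
    TensorProduct.map_map_comp_assoc_eq]

theorem embR_braid (V W X : Comod k C) :
    embR X V W ∘ₗ (cotensorHom (𝟙 X) (braidHom W V)).lin =
      (TensorProduct.comm k W V).toLinearMap.lTensor X ∘ₗ embR X W V := by
  rw [embR, embR, LinearMap.comp_assoc, incl_cotensorHom, ← LinearMap.comp_assoc,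
    LinearMap.lTensor_comp_map, incl_braidHom, id_lin, ← LinearMap.comp_assoc,
    ← LinearMap.lTensor_comp]
  rfl

theorem embL_braid (V W X : Comod k C) :
    embL X W V ∘ₗ (cotensorHom (braidHom W X) (𝟙 V)).lin ∘ₗ (braidHom V (cotensor W X)).lin =
      ((TensorProduct.assoc k X W V).toLinearMap ∘ₗ
        (TensorProduct.comm k W X).toLinearMap.rTensor V ∘ₗ
          (TensorProduct.comm k V (W ⊗[k] X)).toLinearMap) ∘ₗ embR V W X := by
  have h : (incl W X).rTensor V ∘ₗ (TensorProduct.comm k V (cotensor W X)).toLinearMap =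
      (TensorProduct.comm k V (W ⊗[k] X)).toLinearMap ∘ₗ (incl W X).lTensor V := by
    ext; simp
  rw [embL, embR, LinearMap.comp_assoc, LinearMap.comp_assoc,
    ← LinearMap.comp_assoc _ _ (incl (cotensor X W) V), incl_cotensorHom,
    LinearMap.comp_assoc, incl_braidHom, ← LinearMap.comp_assoc _ _ ((incl X W).rTensor V),
    LinearMap.rTensor_comp_map, incl_braidHom, id_lin, ← LinearMap.rTensor_def,
    LinearMap.rTensor_comp, LinearMap.comp_assoc, ← LinearMap.comp_assoc _ _
    ((incl W X).rTensor V), h]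
  rfl

/-- The inverse of the associativity morphism. -/
noncomputable def assocInv (V W X : Comod k C) :
    cotensor V (cotensor W X) ⟶ cotensor (cotensor V W) X :=
  braidHom V (cotensor W X) ≫ cotensorHom (braidHom W X) (𝟙 V) ≫ assocHom X W V ≫
    cotensorHom (𝟙 X) (braidHom W V) ≫ braidHom X (cotensor V W)

theorem embL_assocInv (V W X : Comod k C) :
    embL V W X ∘ₗ (assocInv V W X).lin = embR V W X := by
  simp only [assocInv, comp_lin]
  rw [LinearMap.comp_assoc, LinearMap.comp_assoc, LinearMap.comp_assoc,
    ← LinearMap.comp_assoc _ _ (embL V W X), embL_braidHom, LinearMap.comp_assoc,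
    ← LinearMap.comp_assoc _ _ (embR X V W), embR_braid,
    LinearMap.comp_assoc _ (embR X W V), ← LinearMap.comp_assoc _ _ (embR X W V), embR_assocHom, embL_braid,
    ← LinearMap.comp_assoc, ← LinearMap.comp_assoc]
  conv_rhs => rw [← LinearMap.id_comp (embR V W X)]
  congr 1
  ext
  simp

/-- Associativity of the cotensor product. -/
noncomputable def assocIso (V W X : Comod k C) :
    cotensor (cotensor V W) X ≅ cotensor V (cotensor W X) where
  hom := assocHom V W X
  inv := assocInv V W X
  hom_inv_id := hom_ext <| comp_cancel (embL_injective V W X) <| by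
    rw [comp_lin, ← LinearMap.comp_assoc, embL_assocInv, embR_assocHom]; rfl
  inv_hom_id := hom_ext <| comp_cancel (embR_injective V W X) <| by
    rw [comp_lin, ← LinearMap.comp_assoc, embR_assocHom, embL_assocInv]; rfl

/-- The inclusion of `V ⊗^C C` in `V ⊗ C`. -/
noncomputable def inclU (V : Comod k C) : cotensor V (unit k C) →ₗ[k] V ⊗[k] C :=
  incl V (unit k C)

theorem inclU_coact' (V : Comod k C) :
    (inclU V).rTensor C ∘ₗ (cotensor V (unit k C)).coact = actL V.coact C ∘ₗ inclU V :=
  incl_coact' V (unit k C)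

theorem inclU_coact (V : Comod k C) :
    (inclU V).rTensor C ∘ₗ (cotensor V (unit k C)).coact =
      actR V (Coalgebra.comul (R := k) (A := C)) ∘ₗ inclU V :=
  incl_coact V (unit k C)

theorem coact_actL (V : Comod k C) : V.coact.rTensor C ∘ₗ V.coact =
    actL V.coact C ∘ₗ V.coact := by
  have h : (TensorProduct.rightComm k V C C).toLinearMap ∘ₗ
        (TensorProduct.assoc k V C C).symm.toLinearMap =
      (TensorProduct.assoc k V C C).symm.toLinearMap ∘ₗ
        (TensorProduct.comm k C C).toLinearMap.lTensor V := by
    ext; simp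
  have hc : (TensorProduct.comm k C C).toLinearMap ∘ₗ Coalgebra.comul =
    Coalgebra.comul (R := k) (A := C) := Coalgebra.comm_comp_comul k C
  rw [actL, LinearMap.comp_assoc, coact_actR, actR, LinearMap.comp_assoc,
    ← LinearMap.comp_assoc _ _ (TensorProduct.rightComm k V C C).toLinearMap, h,
    LinearMap.comp_assoc, ← LinearMap.comp_assoc _ (LinearMap.lTensor _ _) (LinearMap.lTensor _ _),
    ← LinearMap.lTensor_comp, hc]

/-- The right unit isomorphism, the restriction of `id ⊗ ε`; its inverse is the coaction. -/
noncomputable def rightUnitorIso (V : Comod k C) : cotensor V (unit k C) ≅ V where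
  hom :=
    { lin := evC V ∘ₗ inclU V
      colinear := by
        rw [LinearMap.rTensor_comp, LinearMap.comp_assoc, inclU_coact', ← LinearMap.comp_assoc,
          evC_actL, LinearMap.comp_assoc] }
  inv := lift (W := unit k C) V.coact (coact_actL V) (coact_actR V)
  hom_inv_id := hom_ext <| comp_cancel (j := inclU V) (incl_injective V (unit k C)) <| by
    change V.coact ∘ₗ evC V ∘ₗ inclU V = inclU V
    rw [← LinearMap.comp_assoc, ← evC_actL, LinearMap.comp_assoc, ← inclU_coact', inclU_coact,
      ← LinearMap.comp_assoc, evC_actR, LinearMap.id_comp]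
  inv_hom_id := hom_ext (evC_coact V)

/-- The symmetry as an isomorphism. -/
noncomputable def braidIso (V W : Comod k C) : cotensor V W ≅ cotensor W V where
  hom := braidHom V W
  inv := braidHom W V
  hom_inv_id := braidHom_braidHom V W
  inv_hom_id := braidHom_braidHom W V

/-- The left unit isomorphism, the restriction of `ε ⊗ id`. -/
noncomputable def leftUnitorIso (V : Comod k C) : cotensor (unit k C) V ≅ V :=
  braidIso (unit k C) V ≪≫ rightUnitorIso V

/-- The inclusion of `C ⊗^C V` in `C ⊗ V`. -/
noncomputable def inclU' (V : Comod k C) : cotensor (unit k C) V →ₗ[k] C ⊗[k] V :=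
  incl (unit k C) V

theorem rightUnitorIso_lin (V : Comod k C) :
    (rightUnitorIso V).hom.lin = evC V ∘ₗ inclU V := rfl

theorem leftUnitorIso_lin (V : Comod k C) :
    (leftUnitorIso V).hom.lin = ((TensorProduct.lid k V).toLinearMap ∘ₗ
      (Coalgebra.counit (R := k) (A := C)).rTensor V) ∘ₗ inclU' V := by
  have h : evC V ∘ₗ (TensorProduct.comm k C V).toLinearMap = (TensorProduct.lid k V).toLinearMap ∘ₗ
      (Coalgebra.counit (R := k) (A := C)).rTensor V := by
    ext; simp [evC]
  rw [← h]
  rfl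

noncomputable instance : MonoidalCategoryStruct (Comod k C) where
  tensorObj := cotensor
  whiskerLeft V _ _ f := cotensorHom (𝟙 V) f
  whiskerRight f V := cotensorHom f (𝟙 V)
  tensorHom := cotensorHom
  tensorUnit := unit k C
  associator := assocIso
  leftUnitor := leftUnitorIso
  rightUnitor := rightUnitorIso

theorem cotensorHom_comp {V V' V'' W W' W'' : Comod k C} (f : V ⟶ V') (f' : V' ⟶ V'')
    (g : W ⟶ W') (g' : W' ⟶ W'') :
    cotensorHom f g ≫ cotensorHom f' g' = cotensorHom (f ≫ f') (g ≫ g') := by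
  apply hom_ext_incl
  rw [comp_lin, ← LinearMap.comp_assoc, incl_cotensorHom, LinearMap.comp_assoc, incl_cotensorHom,
    incl_cotensorHom, ← LinearMap.comp_assoc, ← TensorProduct.map_comp]
  rfl

theorem cotensorHom_id (V W : Comod k C) : cotensorHom (𝟙 V) (𝟙 W) = 𝟙 (cotensor V W) := by
  apply hom_ext_incl
  rw [incl_cotensorHom, id_lin, id_lin, id_lin, TensorProduct.map_id]
  rfl

theorem assoc_natural {V V' W W' X X' : Comod k C} (f : V ⟶ V') (g : W ⟶ W') (h : X ⟶ X') :
    cotensorHom (cotensorHom f g) h ≫ assocHom V' W' X' =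
      assocHom V W X ≫ cotensorHom f (cotensorHom g h) :=
  hom_ext <| comp_cancel (embR_injective _ _ _) <| by
    rw [comp_lin, comp_lin, ← LinearMap.comp_assoc, ← LinearMap.comp_assoc, embR_assocHom,
      embL_whisker, embR_whisker, LinearMap.comp_assoc, embR_assocHom]

theorem embL_eq_apply (V W X : Comod k C) (t : cotensor (cotensor V W) X) :
    embL V W X t = TensorProduct.assoc k V W X ((incl V W).rTensor X
      (incl (cotensor V W) X t)) := rfl

theorem pentagon_aux (V W X Y : Comod k C) :
    cotensorHom (assocHom V W X) (𝟙 Y) ≫ assocHom V (cotensor W X) Y ≫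
        cotensorHom (𝟙 V) (assocHom W X Y) =
      assocHom (cotensor V W) X Y ≫ assocHom V W (cotensor X Y) := by
  apply hom_ext
  apply LinearMap.ext
  intro t
  apply incl_injective
  apply lTensor_inj (embR_injective W X Y) V
  have a1 : ∀ s : cotensor V (cotensor (cotensor W X) Y),
      (embR W X Y).lTensor V (incl _ _ ((cotensorHom (𝟙 V) (assocHom W X Y)).lin s)) =
      (TensorProduct.assoc k W X Y).toLinearMap.lTensor V
        (((incl W X).rTensor Y).lTensor V (embR V (cotensor W X) Y s)) := by
    intro s
    have e := LinearMap.congr_fun (incl_cotensorHom (𝟙 V) (assocHom W X Y)) s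
    simp only [LinearMap.comp_apply] at e
    rw [e, id_lin, ← LinearMap.lTensor_def, ← LinearMap.comp_apply (LinearMap.lTensor _ _),
      ← LinearMap.lTensor_comp, embR_assocHom]
    simp only [embL, embR, LinearMap.lTensor_comp, LinearMap.comp_apply]
  have a2 : ∀ s : cotensor (cotensor V (cotensor W X)) Y,
      ((incl W X).rTensor Y).lTensor V (embL V (cotensor W X) Y s) =
      TensorProduct.assoc k V (W ⊗[k] X) Y ((embR V W X).rTensor Y (incl _ _ s)) := by
    intro s
    have h : ((incl W X).rTensor Y).lTensor V ∘ₗ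
        (TensorProduct.assoc k V (cotensor W X) Y).toLinearMap =
      (TensorProduct.assoc k V (W ⊗[k] X) Y).toLinearMap ∘ₗ ((incl W X).lTensor V).rTensor Y := by
      ext; simp
    rw [embL_eq_apply, embR, LinearMap.rTensor_comp]
    exact LinearMap.congr_fun h _
  have a3 : ∀ s : cotensor (cotensor (cotensor V W) X) Y,
      (embR V W X).rTensor Y (incl _ _ ((cotensorHom (assocHom V W X) (𝟙 Y)).lin s)) =
      (TensorProduct.assoc k V W X).toLinearMap.rTensor Y
        (((incl V W).rTensor X).rTensor Y ((incl (cotensor V W) X).rTensor Y (incl _ _ s))) := by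
    intro s
    have e := LinearMap.congr_fun (incl_cotensorHom (assocHom V W X) (𝟙 Y)) s
    simp only [LinearMap.comp_apply] at e
    rw [e, id_lin, ← LinearMap.rTensor_def, ← LinearMap.comp_apply (LinearMap.rTensor _ _),
      ← LinearMap.rTensor_comp, embR_assocHom]
    simp only [embL, LinearMap.rTensor_comp, LinearMap.comp_apply]
  have a4 : ∀ s : cotensor V (cotensor W (cotensor X Y)),
      (embR W X Y).lTensor V (incl _ _ s) =
      ((incl X Y).lTensor W).lTensor V (embR V W (cotensor X Y) s) := by
    intro s
    simp only [embR, LinearMap.lTensor_comp, LinearMap.comp_apply]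
  have a5 : ∀ s : cotensor (cotensor V W) (cotensor X Y),
      ((incl X Y).lTensor W).lTensor V (embL V W (cotensor X Y) s) =
      TensorProduct.assoc k V W (X ⊗[k] Y) ((incl V W).rTensor (X ⊗[k] Y)
        (embR (cotensor V W) X Y s)) := by
    intro s
    have h : ((incl X Y).lTensor W).lTensor V ∘ₗ
        (TensorProduct.assoc k V W (cotensor X Y)).toLinearMap ∘ₗ
          (incl V W).rTensor (cotensor X Y) =
      (TensorProduct.assoc k V W (X ⊗[k] Y)).toLinearMap ∘ₗ (incl V W).rTensor (X ⊗[k] Y) ∘ₗ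
        (incl X Y).lTensor (cotensor V W) := by
      have h1 : ((incl X Y).lTensor W).lTensor V ∘ₗ
          (TensorProduct.assoc k V W (cotensor X Y)).toLinearMap =
        (TensorProduct.assoc k V W (X ⊗[k] Y)).toLinearMap ∘ₗ (incl X Y).lTensor (V ⊗[k] W) := by
        ext; simp
      rw [← LinearMap.comp_assoc, h1, LinearMap.comp_assoc, LinearMap.lTensor_comp_rTensor,
        LinearMap.rTensor_comp_lTensor]
    exact LinearMap.congr_fun h _
  have a6 : ∀ s : cotensor (cotensor (cotensor V W) X) Y,
      (incl V W).rTensor (X ⊗[k] Y) (embL (cotensor V W) X Y s) =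
      TensorProduct.assoc k (V ⊗[k] W) X Y
        (((incl V W).rTensor X).rTensor Y ((incl (cotensor V W) X).rTensor Y (incl _ _ s))) := by
    intro s
    have h : (incl V W).rTensor (X ⊗[k] Y) ∘ₗ
        (TensorProduct.assoc k (cotensor V W) X Y).toLinearMap =
      (TensorProduct.assoc k (V ⊗[k] W) X Y).toLinearMap ∘ₗ
        ((incl V W).rTensor X).rTensor Y := by
      ext; simp
    exact LinearMap.congr_fun h _
  have b : ∀ (V W X : Comod k C) s, embR V W X ((assocHom V W X).lin s) = embL V W X s :=
    fun V W X s => LinearMap.congr_fun (embR_assocHom V W X) s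
  simp only [comp_lin, LinearMap.comp_apply]
  rw [a1, b, a2, a3, a4, b, a5, b, a6]
  have p : (TensorProduct.assoc k W X Y).toLinearMap.lTensor V ∘ₗ
      (TensorProduct.assoc k V (W ⊗[k] X) Y).toLinearMap ∘ₗ
        (TensorProduct.assoc k V W X).toLinearMap.rTensor Y =
      (TensorProduct.assoc k V W (X ⊗[k] Y)).toLinearMap ∘ₗ
        (TensorProduct.assoc k (V ⊗[k] W) X Y).toLinearMap := by
    ext; simp
  exact LinearMap.congr_fun p _

theorem triangle_aux (V W : Comod k C) :
    assocHom V (unit k C) W ≫ cotensorHom (𝟙 V) (leftUnitorIso W).hom =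
      cotensorHom (rightUnitorIso V).hom (𝟙 W) := by
  apply hom_ext_incl
  have h1 : incl V W ∘ₗ (cotensorHom (𝟙 V) (leftUnitorIso W).hom).lin =
      ((TensorProduct.lid k W).toLinearMap ∘ₗ
        (Coalgebra.counit (R := k) (A := C)).rTensor W).lTensor V ∘ₗ embR V (unit k C) W := by
    rw [incl_cotensorHom, leftUnitorIso_lin, id_lin, ← LinearMap.lTensor_def,
      LinearMap.lTensor_comp, LinearMap.comp_assoc]
    rfl
  have h2 : incl V W ∘ₗ (cotensorHom (rightUnitorIso V).hom (𝟙 W)).lin =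
      (evC V).rTensor W ∘ₗ (inclU V).rTensor W ∘ₗ incl (cotensor V (unit k C)) W := by
    rw [incl_cotensorHom, rightUnitorIso_lin, id_lin, ← LinearMap.rTensor_def,
      LinearMap.rTensor_comp, LinearMap.comp_assoc]
  have h3 : ((TensorProduct.lid k W).toLinearMap ∘ₗ
      (Coalgebra.counit (R := k) (A := C)).rTensor W).lTensor V ∘ₗ
        (TensorProduct.assoc k V C W).toLinearMap = (evC V).rTensor W := by
    ext
    simp [evC, TensorProduct.smul_tmul]
  rw [comp_lin, ← LinearMap.comp_assoc, h1, h2, ← h3]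
  apply LinearMap.ext
  intro t
  exact congrArg (((TensorProduct.lid k W).toLinearMap ∘ₗ
    (Coalgebra.counit (R := k) (A := C)).rTensor W).lTensor V)
    (LinearMap.congr_fun (embR_assocHom V (unit k C) W) t)

theorem rightUnitor_natural {V W : Comod k C} (f : V ⟶ W) :
    cotensorHom f (𝟙 (unit k C)) ≫ (rightUnitorIso W).hom = (rightUnitorIso V).hom ≫ f := by
  apply hom_ext
  have h1 : inclU W ∘ₗ (cotensorHom f (𝟙 (unit k C))).lin = f.lin.rTensor C ∘ₗ inclU V := rfl
  have h2 : evC W ∘ₗ f.lin.rTensor C = f.lin ∘ₗ evC V := by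
    ext; simp [evC]
  rw [comp_lin, comp_lin, rightUnitorIso_lin, rightUnitorIso_lin, LinearMap.comp_assoc, h1,
    ← LinearMap.comp_assoc, h2, LinearMap.comp_assoc]

theorem braid_natural {V V' W W' : Comod k C} (f : V ⟶ V') (g : W ⟶ W') :
    cotensorHom f g ≫ braidHom V' W' = braidHom V W ≫ cotensorHom g f := by
  apply hom_ext_incl
  have h : (TensorProduct.comm k V' W').toLinearMap ∘ₗ TensorProduct.map f.lin g.lin =
      TensorProduct.map g.lin f.lin ∘ₗ (TensorProduct.comm k V W).toLinearMap := by
    ext; simp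
  rw [comp_lin, comp_lin, ← LinearMap.comp_assoc, ← LinearMap.comp_assoc, incl_braidHom,
    incl_cotensorHom, LinearMap.comp_assoc, incl_cotensorHom, ← LinearMap.comp_assoc, h,
    LinearMap.comp_assoc, LinearMap.comp_assoc, incl_braidHom]

theorem leftUnitor_natural {V W : Comod k C} (f : V ⟶ W) :
    cotensorHom (𝟙 (unit k C)) f ≫ (leftUnitorIso W).hom = (leftUnitorIso V).hom ≫ f := by
  change cotensorHom (𝟙 (unit k C)) f ≫ braidHom _ _ ≫ (rightUnitorIso W).hom =
    (braidHom _ _ ≫ (rightUnitorIso V).hom) ≫ f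
  rw [← Category.assoc, braid_natural, Category.assoc, rightUnitor_natural, Category.assoc]

/-- The monoidal category `(Vec^C, ⊗^C, C)`. -/
noncomputable instance : MonoidalCategory (Comod k C) where
  tensorHom_def f g := by
    refine Eq.trans ?_ (cotensorHom_comp f (𝟙 _) (𝟙 _) g).symm
    rw [Category.id_comp, Category.comp_id]
    rfl
  id_tensorHom_id := cotensorHom_id
  tensorHom_comp_tensorHom f₁ f₂ g₁ g₂ := cotensorHom_comp f₁ g₁ f₂ g₂
  whiskerLeft_id := cotensorHom_id
  id_whiskerRight := cotensorHom_id
  associator_naturality := assoc_natural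
  leftUnitor_naturality := leftUnitor_natural
  rightUnitor_naturality := rightUnitor_natural
  pentagon := pentagon_aux
  triangle := triangle_aux

theorem embL_whisker_braid (X Y Z : Comod k C) :
    embL Y X Z ∘ₗ (cotensorHom (braidHom X Y) (𝟙 Z)).lin =
      ((TensorProduct.assoc k Y X Z).toLinearMap ∘ₗ
        (TensorProduct.comm k X Y).toLinearMap.rTensor Z ∘ₗ
          (TensorProduct.assoc k X Y Z).symm.toLinearMap) ∘ₗ embL X Y Z := by
  apply LinearMap.ext
  intro t
  have e := LinearMap.congr_fun (incl_cotensorHom (braidHom X Y) (𝟙 Z)) t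
  simp only [LinearMap.comp_apply] at e
  simp only [LinearMap.comp_apply, embL_eq_apply, LinearEquiv.coe_coe,
    LinearEquiv.symm_apply_apply]
  rw [e, id_lin, ← LinearMap.rTensor_def, ← LinearMap.comp_apply (LinearMap.rTensor _ _),
    ← LinearMap.rTensor_comp, incl_braidHom, LinearMap.rTensor_comp, LinearMap.comp_apply]

theorem embR_braidHom (X Y Z : Comod k C) :
    embR Z X Y ∘ₗ (braidHom (cotensor X Y) Z).lin =
      ((TensorProduct.comm k (X ⊗[k] Y) Z).toLinearMap ∘ₗ
        (TensorProduct.assoc k X Y Z).symm.toLinearMap) ∘ₗ embL X Y Z := by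
  apply LinearMap.ext
  intro t
  have e := LinearMap.congr_fun (incl_braidHom (cotensor X Y) Z) t
  simp only [LinearMap.comp_apply] at e
  simp only [LinearMap.comp_apply, embR, embL_eq_apply, LinearEquiv.coe_coe,
    LinearEquiv.symm_apply_apply]
  rw [e, comm_rTensor]
  rfl

theorem hexagon_forward_aux (X Y Z : Comod k C) :
    assocHom X Y Z ≫ braidHom X (cotensor Y Z) ≫ assocHom Y Z X =
      cotensorHom (braidHom X Y) (𝟙 Z) ≫ assocHom Y X Z ≫
        cotensorHom (𝟙 Y) (braidHom X Z) := by
  apply hom_ext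
  apply comp_cancel (embR_injective Y Z X)
  simp only [comp_lin]
  rw [← LinearMap.comp_assoc, ← LinearMap.comp_assoc, embR_assocHom, embL_braidHom,
    LinearMap.comp_assoc, embR_assocHom, ← LinearMap.comp_assoc, ← LinearMap.comp_assoc,
    embR_braid, LinearMap.comp_assoc _ (embR Y X Z), embR_assocHom,
    LinearMap.comp_assoc _ (embL Y X Z), embL_whisker_braid, ← LinearMap.comp_assoc,
    ← LinearMap.comp_assoc]
  congr 1
  apply comp_cancel_right (TensorProduct.assoc k X Y Z).surjective
  ext
  simp

theorem hexagon_reverse_aux (X Y Z : Comod k C) :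
    assocInv X Y Z ≫ braidHom (cotensor X Y) Z ≫ assocInv Z X Y =
      cotensorHom (𝟙 X) (braidHom Y Z) ≫ assocInv X Z Y ≫
        cotensorHom (braidHom X Z) (𝟙 Y) := by
  apply hom_ext
  apply comp_cancel (embL_injective Z X Y)
  simp only [comp_lin]
  rw [← LinearMap.comp_assoc, ← LinearMap.comp_assoc, embL_assocInv, embR_braidHom,
    LinearMap.comp_assoc, embL_assocInv, ← LinearMap.comp_assoc, ← LinearMap.comp_assoc,
    embL_whisker_braid, LinearMap.comp_assoc _ (embL X Z Y), embL_assocInv,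
    LinearMap.comp_assoc _ (embR X Z Y), embR_braid, ← LinearMap.comp_assoc,
    ← LinearMap.comp_assoc]
  congr 1
  apply comp_cancel_right (TensorProduct.assoc k X Y Z).surjective
  ext
  simp

/-- The symmetric monoidal category `(Vec^C, ⊗^C, C)`. -/
noncomputable instance : SymmetricCategory (Comod k C) where
  braiding := braidIso
  braiding_naturality_right X _ _ f := braid_natural (𝟙 X) f
  braiding_naturality_left f Z := braid_natural f (𝟙 Z)
  hexagon_forward := hexagon_forward_aux
  hexagon_reverse := hexagon_reverse_aux
  symmetry := braidHom_braidHom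

end Comod

section Cosemisimple

variable (k : Type u) [Field k] (C : Type u) [AddCommGroup C] [Module k C] [Coalgebra k C]

variable {C} in
/-- A subspace `D` of `C` is a subcoalgebra if `Δ(D) ⊆ D ⊗ D`. -/
def IsSubcoalgebra (D : Submodule k C) : Prop :=
  ∀ x ∈ D, Coalgebra.comul (R := k) x ∈
    LinearMap.range (TensorProduct.map D.subtype D.subtype)

variable {C} in
/-- A nonzero subcoalgebra which has no subcoalgebras but `0` and itself. -/
structure IsSimpleSubcoalgebra (D : Submodule k C) : Prop where
  isSubcoalgebra : IsSubcoalgebra k D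
  ne_bot : D ≠ ⊥
  eq_bot_or_eq : ∀ E : Submodule k C, E ≤ D → IsSubcoalgebra k E → E = ⊥ ∨ E = D

/-- A coalgebra is cosemisimple if it is the direct sum of simple (sub)coalgebras. -/
def IsCosemisimple : Prop :=
  ∃ (ι : Type u) (D : ι → Submodule k C),
    (∀ i, IsSimpleSubcoalgebra k (D i)) ∧ iSupIndep D ∧ ⨆ i, D i = ⊤

end Cosemisimple

section CoalgOver

variable (k : Type u) [Field k]

/-- The category `Coalg` of cocommutative `k`-coalgebras and morphisms of coalgebras. -/
abbrev Coalg : Type (u + 1) :=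
  ObjectProperty.FullSubcategory (fun D : CoalgCat.{u} k => Coalgebra.IsCocomm k D)

variable (C : Type u) [AddCommGroup C] [Module k C] [Coalgebra k C] [Coalgebra.IsCocomm k C]

/-- A cocommutative coalgebra as an object of `Coalg`. -/
def Coalg.of : Coalg k := ⟨CoalgCat.of k C, ‹Coalgebra.IsCocomm k C›⟩

/-- The category `Coalg C` of cocommutative coalgebras over `C`. -/
abbrev CoalgOver : Type (u + 1) := Over (Coalg.of k C)

variable {k C}

/-- The structure morphism `φ : D → C` of an object of `Coalg C`. -/
def CoalgOver.str (φ : CoalgOver k C) : φ.left.obj →ₗc[k] C :=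
  CoalgCat.Hom.toCoalgHom φ.hom.hom

/-- The coalgebra morphism `D → E` underlying a morphism in `Coalg C`. -/
def CoalgOver.toCoalgHom {φ ψ : CoalgOver k C} (f : φ ⟶ ψ) : φ.left.obj →ₗc[k] ψ.left.obj :=
  CoalgCat.Hom.toCoalgHom f.left.hom

theorem CoalgOver.w {φ ψ : CoalgOver k C} (f : φ ⟶ ψ) :
    ψ.str.toLinearMap ∘ₗ (toCoalgHom f).toLinearMap = φ.str.toLinearMap := by
  have h := congrArg (fun g => (CoalgCat.Hom.toCoalgHom g.hom).toLinearMap) (Over.w f)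
  exact h

theorem isCoassoc_str (φ : CoalgOver k C) :
    IsCoassoc (φ.str.toLinearMap.lTensor φ.left.obj ∘ₗ Coalgebra.comul) := by
  set D := φ.left.obj
  set f : D →ₗ[k] C := φ.str.toLinearMap with hf
  have h1 : (TensorProduct.assoc k D C C).toLinearMap ∘ₗ
      (f.lTensor D ∘ₗ Coalgebra.comul).rTensor C ∘ₗ f.lTensor D =
      (TensorProduct.map f f).lTensor D ∘ₗ (TensorProduct.assoc k D D D).toLinearMap ∘ₗ
        (Coalgebra.comul (R := k) (A := D)).rTensor D := by
    have h2 : (TensorProduct.assoc k D C C).toLinearMap ∘ₗ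
        (f.lTensor D).rTensor C ∘ₗ f.lTensor (D ⊗[k] D) =
      (TensorProduct.map f f).lTensor D ∘ₗ (TensorProduct.assoc k D D D).toLinearMap := by
      ext; simp
    rw [← LinearMap.comp_assoc, ← LinearMap.comp_assoc, ← h2, LinearMap.rTensor_comp]
    simp only [LinearMap.comp_assoc]
    rw [LinearMap.rTensor_comp_lTensor, LinearMap.lTensor_comp_rTensor]
  have h3 : TensorProduct.map f f ∘ₗ Coalgebra.comul = Coalgebra.comul ∘ₗ f :=
    φ.str.map_comp_comul
  unfold IsCoassoc
  rw [← LinearMap.comp_assoc _ (f.lTensor D), ← LinearMap.comp_assoc, h1, LinearMap.comp_assoc,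
    LinearMap.comp_assoc, Coalgebra.coassoc, ← LinearMap.comp_assoc, ← LinearMap.lTensor_comp, h3,
    LinearMap.lTensor_comp, LinearMap.comp_assoc]

theorem isCounital_str (φ : CoalgOver k C) :
    IsCounital (φ.str.toLinearMap.lTensor φ.left.obj ∘ₗ Coalgebra.comul) := by
  have h3 : Coalgebra.counit ∘ₗ φ.str.toLinearMap = Coalgebra.counit := φ.str.counit_comp
  unfold IsCounital
  rw [← LinearMap.comp_assoc, ← LinearMap.lTensor_comp, h3, Coalgebra.lTensor_counit_comp_comul]

theorem colinear_toCoalgHom {φ ψ : CoalgOver k C} (f : φ ⟶ ψ) :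
    (CoalgOver.toCoalgHom f).toLinearMap.rTensor C ∘ₗ
        (φ.str.toLinearMap.lTensor φ.left.obj ∘ₗ Coalgebra.comul) =
      (ψ.str.toLinearMap.lTensor ψ.left.obj ∘ₗ Coalgebra.comul) ∘ₗ
        (CoalgOver.toCoalgHom f).toLinearMap := by
  have h3 := (CoalgOver.toCoalgHom f).map_comp_comul
  rw [LinearMap.comp_assoc, ← h3, ← LinearMap.comp_assoc, ← LinearMap.comp_assoc,
    LinearMap.rTensor_comp_lTensor, LinearMap.lTensor_comp_map, CoalgOver.w]

variable (k C) in
/-- The functor `U^C : Coalg C ⥤ Vec^C`, which takes `φ : D → C` to the space `D` with the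
coaction `(id ⊗ φ) ∘ Δ_D`. -/
noncomputable def U : CoalgOver k C ⥤ Comod k C where
  obj φ :=
    { carrier := φ.left.obj
      coact := φ.str.toLinearMap.lTensor φ.left.obj ∘ₗ Coalgebra.comul
      coassoc := isCoassoc_str φ
      counital := isCounital_str φ }
  map f := ⟨(CoalgOver.toCoalgHom f).toLinearMap, colinear_toCoalgHom f⟩

end CoalgOver

section LNL

universe v₁ v₂ u₁ u₂

/-- `U ⊣ R` as an LNL adjunction: a cartesian structure on `𝒞`, closedness of the symmetric
monoidal category `ℳ`, and an adjunction between (lax) monoidal functors `U` and `R` whose unit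
and counit are monoidal natural transformations. -/
structure LNLAdjunction {𝒞 : Type u₁} [Category.{v₁} 𝒞] {ℳ : Type u₂} [Category.{v₂} ℳ]
    [MonoidalCategory ℳ] [SymmetricCategory ℳ] (U : 𝒞 ⥤ ℳ) (R : ℳ ⥤ 𝒞) where
  /-- finite products on `𝒞` -/
  cartesian : CartesianMonoidalCategory 𝒞
  /-- internal homs on `ℳ` -/
  closed : MonoidalClosed ℳ
  /-- the adjunction -/
  adj : U ⊣ R
  /-- the monoidal structure of `U` -/
  laxU : U.LaxMonoidal
  /-- the monoidal structure of `R` -/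
  laxR : R.LaxMonoidal
  unit_isMonoidal : NatTrans.IsMonoidal adj.unit
  counit_isMonoidal : NatTrans.IsMonoidal adj.counit

/-- The left adjoint is strong monoidal: its structure morphisms are invertible. -/
def LNLAdjunction.IsStrong {𝒞 : Type u₁} [Category.{v₁} 𝒞] {ℳ : Type u₂} [Category.{v₂} ℳ]
    [MonoidalCategory ℳ] [SymmetricCategory ℳ] {U : 𝒞 ⥤ ℳ} {R : ℳ ⥤ 𝒞}
    (L : LNLAdjunction U R) : Prop :=
  letI := L.cartesian
  letI := L.laxU
  IsIso (Functor.LaxMonoidal.ε U) ∧ ∀ X Y : 𝒞, IsIso (Functor.LaxMonoidal.μ U X Y)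

end LNL

end ComodLNL

/-!
The functor `U` has a right adjoint as soon as, for every comodule `W`, the category of arrows from
`U φ` to `W` has a terminal object. Every element of a cocommutative coalgebra lies in a
finite-dimensional subcoalgebra, so each such arrow is covered by arrows from finite-dimensional
coalgebras over `C`, and these form a small family up to isomorphism. The direct sum of the family
has induced maps to `C` and to `W`, and its quotient by the largest coideal on which both vanish is
the terminal object.

The product of `D` and `E` in `Coalg C` is the cotensor product inside the coalgebra `D ⊗ E`, so
`U` is strong monoidal and its right adjoint inherits a lax monoidal structure for which unit and
counit are monoidal.

If `C` is cosemisimple, every cofree comodule `M ⊗ C` is a semisimple module over the dual algebra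
of `C`. Hence the coaction `V ⟶ V ⊗ C` is a split monomorphism and `V ⊗^C -` is a retract of
`(V ⊗ C) ⊗^C -`. The underlying space of `(V ⊗ C) ⊗^C X` is `V ⊗ X`, so that functor, and with it
its retract, has a right adjoint by the adjoint triangle theorem.
-/

namespace ComodLNL

universe v₁ v₂ u₁ u₂

/-! ### Contractions -/

section Slice

variable {R M N P P' : Type*} [CommSemiring R] [AddCommMonoid M] [Module R M] [AddCommMonoid N]
  [Module R N] [AddCommMonoid P] [Module R P] [AddCommMonoid P'] [Module R P']

variable (M) in
/-- Contraction of the second factor of `M ⊗ P` with a functional on `P`. It turns coactions of a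
coalgebra into actions of its dual. -/
noncomputable def slice : Module.Dual R P →ₗ[R] M ⊗[R] P →ₗ[R] M :=
  (LinearMap.lTensorHom M).compr₂ (TensorProduct.rid R M).toLinearMap

@[simp]
theorem slice_tmul (ξ : Module.Dual R P) (m : M) (p : P) : slice M ξ (m ⊗ₜ p) = ξ p • m := by
  simp [slice]

theorem slice_rTensor (ξ : Module.Dual R P) (f : M →ₗ[R] N) (z : M ⊗[R] P) :
    slice N ξ (f.rTensor P z) = f (slice M ξ z) := by
  have h : slice N ξ ∘ₗ f.rTensor P = f ∘ₗ slice M ξ := by ext; simp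
  exact LinearMap.congr_fun h z

theorem slice_lTensor (ξ : Module.Dual R P') (f : P →ₗ[R] P') (z : M ⊗[R] P) :
    slice M ξ (f.lTensor M z) = slice M (ξ ∘ₗ f) z := by
  have h : slice M ξ ∘ₗ f.lTensor M = slice M (ξ ∘ₗ f) := by ext; simp
  exact LinearMap.congr_fun h z

variable (R P) in
theorem slice_counit_comp_comul [Coalgebra R P] :
    slice P (Coalgebra.counit (R := R)) ∘ₗ Coalgebra.comul = LinearMap.id := by
  rw [← LinearMap.id_comp (Coalgebra.counit (R := R) (A := P))]
  ext x
  rw [LinearMap.comp_apply, ← slice_lTensor, Coalgebra.lTensor_counit_comul, slice_tmul]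
  simp

theorem slice_coord {ι : Type*} [DecidableEq ι] (b : Module.Basis ι R P) (i : ι) (z : M ⊗[R] P) :
    slice M (b.coord i) z = TensorProduct.equivFinsuppOfBasisRight b z i := by
  have h : slice M (b.coord i) = Finsupp.lapply (R := R) i ∘ₗ
      (TensorProduct.equivFinsuppOfBasisRight (M := M) b).toLinearMap := by
    ext; simp
  exact LinearMap.congr_fun h z

theorem eq_of_slice_eq [Module.Free R P] {z w : M ⊗[R] P}
    (h : ∀ ξ : Module.Dual R P, slice M ξ z = slice M ξ w) : z = w := by
  classical
  let b := Module.Free.chooseBasis R P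
  apply (TensorProduct.equivFinsuppOfBasisRight (M := M) b).injective
  ext i
  rw [← slice_coord, ← slice_coord, h]

/-- The submodule of `M` consisting of all contractions of a given element of `M ⊗ P`. -/
noncomputable def slices (z : M ⊗[R] P) : Submodule R M :=
  LinearMap.range ((slice M).flip z)

end Slice

section SliceRing

variable {R M P : Type*} [CommRing R] [AddCommGroup M] [Module R M] [AddCommGroup P] [Module R P]

theorem fg_slices [IsNoetherianRing R] (z : M ⊗[R] P) : (slices z).FG := by
  classical
  obtain ⟨S, rfl⟩ := TensorProduct.exists_finset z
  refine (Submodule.fg_span (S.image Prod.fst).finite_toSet).of_le ?_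
  rintro _ ⟨ξ, rfl⟩
  rw [LinearMap.flip_apply, map_sum]
  refine Submodule.sum_mem _ fun i hi => ?_
  rw [slice_tmul]
  exact Submodule.smul_mem _ _ (Submodule.subset_span (Finset.mem_image_of_mem _ hi))

theorem mem_range_rTensor_subtype_iff_slice_mem [Module.Free R P] {K : Submodule R M}
    {z : M ⊗[R] P} :
    z ∈ LinearMap.range (K.subtype.rTensor P) ↔ ∀ ξ : Module.Dual R P, slice M ξ z ∈ K := by
  rw [← rTensor_mkQ, LinearMap.mem_ker]
  constructor
  · intro hz ξ
    rw [← Submodule.Quotient.mk_eq_zero, ← Submodule.mkQ_apply, ← slice_rTensor, hz, map_zero]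
  · intro hz
    refine eq_of_slice_eq fun ξ => ?_
    rw [slice_rTensor, map_zero]
    exact (Submodule.Quotient.mk_eq_zero K).2 (hz ξ)

end SliceRing

/-! ### Subcoalgebras -/

section CoalgebraOfInjective

variable {R A X : Type*} [CommRing R] [AddCommGroup A] [Module R A] [Module.Flat R A]
  [AddCommGroup X] [Module R X] [Coalgebra R X] [Module.Flat R X]

/-- The coalgebra structure on a module which embeds in a coalgebra, for a comultiplication
compatible with the embedding. -/
noncomputable abbrev coalgebraOfInjective (j : A →ₗ[R] X) (hj : Function.Injective j)
    (Δ : A →ₗ[R] A ⊗[R] A) (h : TensorProduct.map j j ∘ₗ Δ = Coalgebra.comul ∘ₗ j) :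
    Coalgebra R A where
  comul := Δ
  counit := Coalgebra.counit ∘ₗ j
  coassoc := by
    have hjj : Function.Injective (TensorProduct.map j (TensorProduct.map j j)) :=
      TensorProduct.map_injective_of_flat_flat _ _ hj
        (TensorProduct.map_injective_of_flat_flat _ _ hj hj)
    rw [← LinearMap.cancel_left hjj]
    calc TensorProduct.map j (TensorProduct.map j j) ∘ₗ
          (TensorProduct.assoc R A A A).toLinearMap ∘ₗ Δ.rTensor A ∘ₗ Δ
        = (TensorProduct.assoc R X X X).toLinearMap ∘ₗ
            TensorProduct.map (TensorProduct.map j j ∘ₗ Δ) j ∘ₗ Δ := by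
          simp only [coassoc_simps]
      _ = ((TensorProduct.assoc R X X X).toLinearMap ∘ₗ Coalgebra.comul.rTensor X ∘ₗ
            Coalgebra.comul) ∘ₗ j := by
          rw [LinearMap.comp_assoc, LinearMap.comp_assoc, ← h,
            ← LinearMap.comp_assoc _ _ (Coalgebra.comul.rTensor X), LinearMap.rTensor_comp_map, ← h]
      _ = (Coalgebra.comul.lTensor X ∘ₗ Coalgebra.comul) ∘ₗ j := by rw [Coalgebra.coassoc]
      _ = TensorProduct.map j (TensorProduct.map j j ∘ₗ Δ) ∘ₗ Δ := by
          rw [LinearMap.comp_assoc, ← h, ← LinearMap.comp_assoc, LinearMap.lTensor_comp_map, ← h]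
      _ = TensorProduct.map j (TensorProduct.map j j) ∘ₗ Δ.lTensor A ∘ₗ Δ := by
          simp only [coassoc_simps]
  rTensor_counit_comp_comul := by
    rw [← LinearMap.cancel_left (Module.Flat.lTensor_preserves_injective_linearMap j hj)]
    calc j.lTensor R ∘ₗ (Coalgebra.counit ∘ₗ j).rTensor A ∘ₗ Δ
        = Coalgebra.counit.rTensor X ∘ₗ TensorProduct.map j j ∘ₗ Δ := by
          simp only [coassoc_simps]
      _ = j.lTensor R ∘ₗ TensorProduct.mk R R A 1 := by
          rw [h, ← LinearMap.comp_assoc, Coalgebra.rTensor_counit_comp_comul]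
          ext; simp
  lTensor_counit_comp_comul := by
    rw [← LinearMap.cancel_left (Module.Flat.rTensor_preserves_injective_linearMap j hj)]
    calc j.rTensor R ∘ₗ (Coalgebra.counit ∘ₗ j).lTensor A ∘ₗ Δ
        = Coalgebra.counit.lTensor X ∘ₗ TensorProduct.map j j ∘ₗ Δ := by
          simp only [coassoc_simps]
      _ = j.rTensor R ∘ₗ (TensorProduct.mk R A R).flip 1 := by
          rw [h, ← LinearMap.comp_assoc, Coalgebra.lTensor_counit_comp_comul]
          ext; simp

theorem isCocomm_of_injective [Coalgebra R A] [Coalgebra.IsCocomm R X] (j : A →ₗc[R] X)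
    (hj : Function.Injective j) : Coalgebra.IsCocomm R A := by
  have hjj : Function.Injective (TensorProduct.map j.toLinearMap j.toLinearMap) :=
    TensorProduct.map_injective_of_flat_flat _ _ hj hj
  refine ⟨(LinearMap.cancel_left hjj).1 ?_⟩
  calc TensorProduct.map j.toLinearMap j.toLinearMap ∘ₗ
        (TensorProduct.comm R A A).toLinearMap ∘ₗ Coalgebra.comul
      = (TensorProduct.comm R X X).toLinearMap ∘ₗ
          TensorProduct.map j.toLinearMap j.toLinearMap ∘ₗ Coalgebra.comul := by
        simp only [coassoc_simps]
    _ = TensorProduct.map j.toLinearMap j.toLinearMap ∘ₗ Coalgebra.comul := by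
        rw [j.map_comp_comul, ← LinearMap.comp_assoc]
        exact congrArg (· ∘ₗ j.toLinearMap) (Coalgebra.comm_comp_comul R X)

end CoalgebraOfInjective

section Submodule

variable {R X : Type*} [CommRing R] [AddCommGroup X] [Module R X] (N : Submodule R X)

theorem map_subtype_injective [Module.Flat R N] [Module.Flat R X] :
    Function.Injective (TensorProduct.map N.subtype N.subtype) :=
  TensorProduct.map_injective_of_flat_flat _ _ N.injective_subtype N.injective_subtype

theorem range_rTensor_inf_range_lTensor_le [Module.Flat R (X ⧸ N)] :
    LinearMap.range (N.subtype.rTensor X) ⊓ LinearMap.range (N.subtype.lTensor X) ≤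
      LinearMap.range (TensorProduct.map N.subtype N.subtype) := by
  rintro _ ⟨⟨y, rfl⟩, hy⟩
  have hzero : N.mkQ.lTensor N y = 0 := by
    apply Module.Flat.rTensor_preserves_injective_linearMap N.subtype N.injective_subtype
    rw [← LinearMap.comp_apply, LinearMap.rTensor_comp_lTensor, ← LinearMap.lTensor_comp_rTensor,
      LinearMap.comp_apply, map_zero, ← LinearMap.mem_ker, lTensor_mkQ]
    exact hy
  rw [← LinearMap.mem_ker, lTensor_mkQ] at hzero
  obtain ⟨w, rfl⟩ := hzero
  exact ⟨w, by rw [← LinearMap.rTensor_comp_lTensor, LinearMap.comp_apply]⟩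

end Submodule

section Subcoalgebra

variable {k X Y : Type u} [Field k] [AddCommGroup X] [Module k X] [Coalgebra k X]
  [AddCommGroup Y] [Module k Y] [Coalgebra k Y] {N : Submodule k X}

/-- The comultiplication of a subcoalgebra. -/
noncomputable def subComul (hN : IsSubcoalgebra k N) : N →ₗ[k] N ⊗[k] N :=
  liftInj (TensorProduct.map N.subtype N.subtype) (map_subtype_injective N)
    (Coalgebra.comul ∘ₗ N.subtype) fun x => hN x x.2

theorem map_subtype_comp_subComul (hN : IsSubcoalgebra k N) :
    TensorProduct.map N.subtype N.subtype ∘ₗ subComul hN = Coalgebra.comul ∘ₗ N.subtype :=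
  comp_liftInj _ _ _ _

/-- A subcoalgebra as a coalgebra. -/
noncomputable abbrev subCoalgebra (hN : IsSubcoalgebra k N) : Coalgebra k N :=
  coalgebraOfInjective N.subtype N.injective_subtype (subComul hN) (map_subtype_comp_subComul hN)

/-- The inclusion of a subcoalgebra as a coalgebra morphism. -/
noncomputable def subCoalgHom (hN : IsSubcoalgebra k N) :
    letI := subCoalgebra hN
    N →ₗc[k] X :=
  letI := subCoalgebra hN
  { N.subtype with
    counit_comp := rfl
    map_comp_comul := map_subtype_comp_subComul hN }

theorem isCocomm_subCoalgebra [Coalgebra.IsCocomm k X] (hN : IsSubcoalgebra k N) :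
    letI := subCoalgebra hN
    Coalgebra.IsCocomm k N :=
  letI := subCoalgebra hN
  isCocomm_of_injective (subCoalgHom hN) N.injective_subtype

/-- The corestriction of a coalgebra morphism to a subcoalgebra. -/
noncomputable def subCoalgLift (hN : IsSubcoalgebra k N) (f : Y →ₗc[k] X) (hf : ∀ y, f y ∈ N) :
    letI := subCoalgebra hN
    Y →ₗc[k] N :=
  letI := subCoalgebra hN
  { f.toLinearMap.codRestrict N hf with
    counit_comp := f.counit_comp
    map_comp_comul := by
      have hsub : N.subtype ∘ₗ f.toLinearMap.codRestrict N hf = f.toLinearMap := rfl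
      rw [← LinearMap.cancel_left (map_subtype_injective N)]
      calc TensorProduct.map N.subtype N.subtype ∘ₗ
            TensorProduct.map (f.toLinearMap.codRestrict N hf) (f.toLinearMap.codRestrict N hf) ∘ₗ
              Coalgebra.comul
          = TensorProduct.map f.toLinearMap f.toLinearMap ∘ₗ Coalgebra.comul := by
            rw [← LinearMap.comp_assoc, ← TensorProduct.map_comp, hsub]
        _ = Coalgebra.comul ∘ₗ N.subtype ∘ₗ f.toLinearMap.codRestrict N hf := by
            rw [f.map_comp_comul, hsub]
        _ = TensorProduct.map N.subtype N.subtype ∘ₗ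
              subComul hN ∘ₗ f.toLinearMap.codRestrict N hf := by
            rw [← LinearMap.comp_assoc, ← map_subtype_comp_subComul hN, LinearMap.comp_assoc] }

theorem isSubcoalgebra_of_slice_mem [Coalgebra.IsCocomm k X]
    (h : ∀ x ∈ N, ∀ ξ : Module.Dual k X, slice X ξ (Coalgebra.comul x) ∈ N) :
    IsSubcoalgebra k N := by
  intro x hx
  obtain ⟨y, hy⟩ := mem_range_rTensor_subtype_iff_slice_mem.2 (h x hx)
  refine range_rTensor_inf_range_lTensor_le N ⟨⟨y, hy⟩, TensorProduct.comm k N X y, ?_⟩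
  rw [← comm_rTensor, hy, Coalgebra.comm_comul]

theorem IsSubcoalgebra.slice_mem (hN : IsSubcoalgebra k N) {x : X} (hx : x ∈ N)
    (ξ : Module.Dual k X) : slice X ξ (Coalgebra.comul x) ∈ N := by
  obtain ⟨y, hy⟩ := hN x hx
  refine mem_range_rTensor_subtype_iff_slice_mem.1 ⟨N.subtype.lTensor N y, ?_⟩ ξ
  rw [← hy, ← LinearMap.comp_apply, LinearMap.rTensor_comp_lTensor]

theorem slice_slice_of_isCoassoc {M : Type u} [AddCommGroup M] [Module k M]
    {a : M →ₗ[k] M ⊗[k] X} (ha : IsCoassoc a) (ξ η : Module.Dual k X) (m : M) :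
    slice M η (a (slice M ξ (a m))) =
      slice M (WithConv.toConv η * WithConv.toConv ξ).ofConv (a m) := by
  have hslice : slice M η ∘ₗ slice (M ⊗[k] X) ξ =
      slice M (LinearMap.mul' k k ∘ₗ TensorProduct.map η ξ) ∘ₗ
        (TensorProduct.assoc k M X X).toLinearMap := by
    ext; simp [smul_smul, mul_comm]
  calc slice M η (a (slice M ξ (a m)))
      = slice M η (slice (M ⊗[k] X) ξ (a.rTensor X (a m))) := by rw [slice_rTensor]
    _ = slice M (LinearMap.mul' k k ∘ₗ TensorProduct.map η ξ)
          (TensorProduct.assoc k M X X (a.rTensor X (a m))) := LinearMap.congr_fun hslice _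
    _ = slice M (LinearMap.mul' k k ∘ₗ TensorProduct.map η ξ)
          (Coalgebra.comul.lTensor M (a m)) := congrArg _ (LinearMap.congr_fun ha m)
    _ = slice M (WithConv.toConv η * WithConv.toConv ξ).ofConv (a m) := by
          rw [slice_lTensor, LinearMap.comp_assoc, LinearMap.convMul_def]

theorem exists_finiteDimensional_subcoalgebra [Coalgebra.IsCocomm k X] (x : X) :
    ∃ N : Submodule k X, IsSubcoalgebra k N ∧ FiniteDimensional k N ∧ x ∈ N := by
  refine ⟨slices (Coalgebra.comul (R := k) x), isSubcoalgebra_of_slice_mem ?_,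
    Module.Finite.iff_fg.2 (fg_slices _),
    ⟨Coalgebra.counit, LinearMap.congr_fun (slice_counit_comp_comul k X) x⟩⟩
  rintro _ ⟨ξ, rfl⟩ η
  exact ⟨_, (slice_slice_of_isCoassoc Coalgebra.coassoc ξ η x).symm⟩

end Subcoalgebra

/-! ### Coideals -/

section Coideal

variable {R X Y : Type*} [CommRing R] [AddCommGroup X] [Module R X] [Coalgebra R X]
  [AddCommGroup Y] [Module R Y] [Coalgebra R Y]

theorem isCoideal_sSup {S : Set (Submodule R X)} (hS : ∀ J ∈ S, J.IsCoideal) :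
    (sSup S).IsCoideal where
  counit_eq_zero := by
    have hker : sSup S ≤ LinearMap.ker (Coalgebra.counit (R := R) (A := X)) :=
      sSup_le fun J hJ x hx => (hS J hJ).counit_eq_zero hx
    exact fun x hx => hker hx
  map_mkQ_comul_eq_zero := by
    have hker : sSup S ≤ LinearMap.ker
        (TensorProduct.map (sSup S).mkQ (sSup S).mkQ ∘ₗ Coalgebra.comul) := by
      refine sSup_le fun J hJ x hx => ?_
      rw [LinearMap.mem_ker, LinearMap.comp_apply, ← Submodule.factor_comp_mk (le_sSup hJ),
        TensorProduct.map_comp, LinearMap.comp_apply, (hS J hJ).map_mkQ_comul_eq_zero hx, map_zero]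
    exact fun x hx => hker hx

theorem isCoideal_range_sub (f g : Y →ₗc[R] X) :
    (LinearMap.range (f.toLinearMap - g.toLinearMap)).IsCoideal where
  counit_eq_zero := by
    rintro _ ⟨y, rfl⟩
    rw [LinearMap.sub_apply, map_sub, ← LinearMap.comp_apply, ← LinearMap.comp_apply,
      f.counit_comp, g.counit_comp, sub_self]
  map_mkQ_comul_eq_zero := by
    set I := LinearMap.range (f.toLinearMap - g.toLinearMap)
    have hfg : I.mkQ ∘ₗ f.toLinearMap = I.mkQ ∘ₗ g.toLinearMap := by
      rw [← sub_eq_zero, ← LinearMap.comp_sub]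
      exact LinearMap.range_le_ker_iff.1 (Submodule.ker_mkQ I).ge
    have hcomul (h : Y →ₗc[R] X) :
        (TensorProduct.map I.mkQ I.mkQ ∘ₗ Coalgebra.comul) ∘ₗ h.toLinearMap =
          TensorProduct.map (I.mkQ ∘ₗ h.toLinearMap) (I.mkQ ∘ₗ h.toLinearMap) ∘ₗ
            Coalgebra.comul := by
      rw [LinearMap.comp_assoc, ← h.map_comp_comul, TensorProduct.map_comp, LinearMap.comp_assoc]
    have heq : (TensorProduct.map I.mkQ I.mkQ ∘ₗ Coalgebra.comul) ∘ₗ f.toLinearMap =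
        (TensorProduct.map I.mkQ I.mkQ ∘ₗ Coalgebra.comul) ∘ₗ g.toLinearMap := by
      rw [hcomul, hcomul, hfg]
    rintro _ ⟨y, rfl⟩
    rw [LinearMap.sub_apply, map_sub, map_sub]
    exact sub_eq_zero.2 (LinearMap.congr_fun heq y)

theorem isCocomm_quotient [Coalgebra.IsCocomm R X] (I : Submodule R X) [I.IsCoideal] :
    Coalgebra.IsCocomm R (X ⧸ I) := by
  refine ⟨(LinearMap.cancel_right I.mkQ_surjective).1 ?_⟩
  calc ((TensorProduct.comm R (X ⧸ I) (X ⧸ I)).toLinearMap ∘ₗ Coalgebra.comul) ∘ₗ I.mkQ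
      = TensorProduct.map I.mkQ I.mkQ ∘ₗ
          (TensorProduct.comm R X X).toLinearMap ∘ₗ Coalgebra.comul := by
        rw [LinearMap.comp_assoc, Coalgebra.Quotient.comul_comp_mkQ]
        simp only [coassoc_simps]
    _ = Coalgebra.comul ∘ₗ I.mkQ := by
        rw [Coalgebra.Quotient.comul_comp_mkQ]
        exact congrArg _ (Coalgebra.comm_comp_comul R X)

theorem isCoideal_ker {k X Y : Type*} [Field k] [AddCommGroup X] [Module k X] [Coalgebra k X]
    [AddCommGroup Y] [Module k Y] [Coalgebra k Y] (f : X →ₗc[k] Y) :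
    (LinearMap.ker f.toLinearMap).IsCoideal where
  counit_eq_zero x hx := by
    rw [← f.counit_comp, LinearMap.comp_apply, LinearMap.mem_ker.1 hx, map_zero]
  map_mkQ_comul_eq_zero x hx := by
    have hinj : Function.Injective ((LinearMap.ker f.toLinearMap).liftQ f.toLinearMap le_rfl) :=
      LinearMap.ker_eq_bot.1 (Submodule.ker_liftQ_eq_bot _ _ _ le_rfl)
    apply TensorProduct.map_injective_of_flat_flat _ _ hinj hinj
    rw [map_zero, ← LinearMap.comp_apply, ← TensorProduct.map_comp, Submodule.liftQ_mkQ,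
      ← LinearMap.comp_apply, f.map_comp_comul, LinearMap.comp_apply, LinearMap.mem_ker.1 hx,
      map_zero]

end Coideal

section MaxCoideal

variable {R X Y E V : Type*} [CommRing R] [AddCommGroup X] [Module R X] [Coalgebra R X]
  [AddCommGroup Y] [Module R Y] [Coalgebra R Y] [AddCommGroup E] [Module R E] [Coalgebra R E]
  [AddCommGroup V] [Module R V]

/-- The largest coideal on which a linear map vanishes. -/
def maxCoideal (q : X →ₗ[R] V) : Submodule R X :=
  sSup {J | J.IsCoideal ∧ J ≤ LinearMap.ker q}

instance (q : X →ₗ[R] V) : (maxCoideal q).IsCoideal :=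
  isCoideal_sSup fun _ hJ => hJ.1

theorem maxCoideal_le_ker (q : X →ₗ[R] V) : maxCoideal q ≤ LinearMap.ker q :=
  sSup_le fun _ hJ => hJ.2

theorem le_maxCoideal {q : X →ₗ[R] V} {J : Submodule R X} (hJ : J.IsCoideal)
    (h : J ≤ LinearMap.ker q) : J ≤ maxCoideal q :=
  le_sSup ⟨hJ, h⟩

theorem sub_mem_maxCoideal {q : X →ₗ[R] V} {f g : Y →ₗc[R] X}
    (h : q ∘ₗ f.toLinearMap = q ∘ₗ g.toLinearMap) (y : Y) : f y - g y ∈ maxCoideal q := by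
  have hle : LinearMap.range (f.toLinearMap - g.toLinearMap) ≤ maxCoideal q :=
    le_maxCoideal (isCoideal_range_sub f g) <| by
      rw [LinearMap.range_le_ker_iff, LinearMap.comp_sub, h, sub_self]
  exact hle ⟨y, rfl⟩

theorem coalgHom_ext_of_maxCoideal_eq_bot {q : X →ₗ[R] V} (hq : maxCoideal q = ⊥)
    {f g : Y →ₗc[R] X} (h : q ∘ₗ f.toLinearMap = q ∘ₗ g.toLinearMap) : f = g :=
  CoalgHom.ext fun y => sub_eq_zero.1 <| (Submodule.mem_bot R).1 <| hq ▸ sub_mem_maxCoideal h y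

/-- The linear map induced by `q` on the quotient by `maxCoideal q`. -/
noncomputable def maxQuotMap (q : X →ₗ[R] V) : X ⧸ maxCoideal q →ₗ[R] V :=
  (maxCoideal q).liftQ q (maxCoideal_le_ker q)

/-- The first coprojection of a direct sum of coalgebras. -/
def inlCoalgHom (R X Y : Type*) [CommRing R] [AddCommGroup X] [Module R X] [Coalgebra R X]
    [AddCommGroup Y] [Module R Y] [Coalgebra R Y] : X →ₗc[R] X × Y :=
  { LinearMap.inl R X Y with
    counit_comp := Prod.counit_comp_inl R X Y
    map_comp_comul := (Prod.comul_comp_inl R X Y).symm }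

/-- The second coprojection of a direct sum of coalgebras. -/
def inrCoalgHom (R X Y : Type*) [CommRing R] [AddCommGroup X] [Module R X] [Coalgebra R X]
    [AddCommGroup Y] [Module R Y] [Coalgebra R Y] : Y →ₗc[R] X × Y :=
  { LinearMap.inr R X Y with
    counit_comp := Prod.counit_comp_inr R X Y
    map_comp_comul := (Prod.comul_comp_inr R X Y).symm }

theorem mk_neg_mem_maxCoideal_coprod {p : Y →ₗ[R] V} {q : X →ₗ[R] V} (i : E →ₗc[R] Y)
    (g : E →ₗc[R] X) (h : q ∘ₗ g.toLinearMap = p ∘ₗ i.toLinearMap) (e : E) :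
    (i e, -g e) ∈ maxCoideal (p.coprod q) := by
  have hcoprod : p.coprod q ∘ₗ ((inlCoalgHom R Y X).comp i).toLinearMap =
      p.coprod q ∘ₗ ((inrCoalgHom R Y X).comp g).toLinearMap :=
    calc p.coprod q ∘ₗ ((inlCoalgHom R Y X).comp i).toLinearMap
        = p ∘ₗ i.toLinearMap := congrArg (· ∘ₗ i.toLinearMap) (LinearMap.coprod_inl p q)
      _ = q ∘ₗ g.toLinearMap := h.symm
      _ = p.coprod q ∘ₗ ((inrCoalgHom R Y X).comp g).toLinearMap :=
        congrArg (· ∘ₗ g.toLinearMap) (LinearMap.coprod_inr p q).symm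
  have hsub : ((i e, 0) - (0, g e) : Y × X) = (i e, -g e) := by
    rw [Prod.mk_sub_mk, sub_zero, zero_sub]
  exact hsub ▸ sub_mem_maxCoideal hcoprod e

/-- The second coprojection into the quotient of a direct sum by `maxCoideal (p.coprod q)`. -/
noncomputable def coprodQuotInr (p : Y →ₗ[R] V) (q : X →ₗ[R] V) :
    X →ₗc[R] (Y × X) ⧸ maxCoideal (p.coprod q) :=
  (Coalgebra.Quotient.mkQCoalgHom (R := R) (maxCoideal (p.coprod q))).comp (inrCoalgHom R Y X)

theorem maxQuotMap_comp_coprodQuotInr (p : Y →ₗ[R] V) (q : X →ₗ[R] V) :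
    maxQuotMap (p.coprod q) ∘ₗ (coprodQuotInr p q).toLinearMap = q :=
  LinearMap.coprod_inr p q

theorem coprodQuotInr_surjective {p : Y →ₗ[R] V} {q : X →ₗ[R] V}
    (h : ∀ y, ∃ x, (y, -x) ∈ maxCoideal (p.coprod q)) :
    Function.Surjective (coprodQuotInr p q) := by
  intro z
  obtain ⟨⟨y, x⟩, rfl⟩ := (maxCoideal (p.coprod q)).mkQ_surjective z
  obtain ⟨x', hx'⟩ := h y
  refine ⟨x + x', Eq.symm ((Submodule.Quotient.eq _).2 ?_)⟩
  have heq : (y, x) - ((0 : Y), x + x') = (y, -x') := Prod.ext (sub_zero _) (by simp)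
  exact heq ▸ hx'

end MaxCoideal

section Field

variable {k X Y V : Type*} [Field k] [AddCommGroup X] [Module k X] [Coalgebra k X]
  [AddCommGroup Y] [Module k Y] [Coalgebra k Y] [AddCommGroup V] [Module k V]

theorem maxCoideal_maxQuotMap (q : X →ₗ[k] V) : maxCoideal (maxQuotMap q) = ⊥ := by
  set I := maxCoideal q
  set J := maxCoideal (maxQuotMap q)
  let π := (Coalgebra.Quotient.mkQCoalgHom (R := k) J).comp
    (Coalgebra.Quotient.mkQCoalgHom (R := k) I)
  have hker : LinearMap.ker π.toLinearMap = J.comap I.mkQ := by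
    calc LinearMap.ker π.toLinearMap = (LinearMap.ker J.mkQ).comap I.mkQ :=
          LinearMap.ker_comp I.mkQ J.mkQ
      _ = J.comap I.mkQ := by rw [Submodule.ker_mkQ]
  have hle : J.comap I.mkQ ≤ I := by
    rw [← hker]
    refine le_maxCoideal (isCoideal_ker π) ?_
    rw [hker]
    exact fun x hx => maxCoideal_le_ker (maxQuotMap q) hx
  rw [eq_bot_iff]
  intro x hx
  obtain ⟨x, rfl⟩ := I.mkQ_surjective x
  exact (Submodule.Quotient.mk_eq_zero I).2 (hle hx)

theorem coprodQuotInr_injective (p : Y →ₗ[k] V) {q : X →ₗ[k] V} (hq : maxCoideal q = ⊥) :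
    Function.Injective (coprodQuotInr p q) := by
  have hle : LinearMap.ker (coprodQuotInr p q).toLinearMap ≤ maxCoideal q := by
    refine le_maxCoideal (isCoideal_ker _) ?_
    conv_rhs => rw [← maxQuotMap_comp_coprodQuotInr p q]
    exact LinearMap.ker_le_ker_comp _ _
  exact LinearMap.ker_eq_bot.1 (le_bot_iff.1 (hle.trans_eq hq))

/-- The elements `(y, -x)` of `maxCoideal (p.coprod q)` form the graph of the morphism. -/
theorem exists_coalgHom_comp_eq {p : Y →ₗ[k] V} {q : X →ₗ[k] V} (hq : maxCoideal q = ⊥)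
    (h : ∀ y, ∃ x, (y, -x) ∈ maxCoideal (p.coprod q)) :
    ∃ g : Y →ₗc[k] X, q ∘ₗ g.toLinearMap = p := by
  let π := Coalgebra.Quotient.mkQCoalgHom (R := k) (maxCoideal (p.coprod q))
  let e := CoalgEquiv.ofBijective (f := coprodQuotInr p q)
    ⟨coprodQuotInr_injective p hq, coprodQuotInr_surjective h⟩
  refine ⟨(e.symm : _ →ₗc[k] X).comp (π.comp (inlCoalgHom k Y X)), LinearMap.ext fun y => ?_⟩
  calc q (e.symm (π (y, 0)))
      = maxQuotMap (p.coprod q) (e (e.symm (π (y, 0)))) :=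
        (LinearMap.congr_fun (maxQuotMap_comp_coprodQuotInr p q) _).symm
    _ = maxQuotMap (p.coprod q) (π (y, 0)) := congrArg _ (e.apply_symm_apply _)
    _ = p y := LinearMap.congr_fun (LinearMap.coprod_inl p q) y

end Field

/-! ### Products over a cocommutative coalgebra -/

section EqSubcoalgebra

theorem lTensor_rTensor_comm_apply {R M M' P P' : Type*} [CommSemiring R] [AddCommMonoid M]
    [Module R M] [AddCommMonoid M'] [Module R M'] [AddCommMonoid P] [Module R P] [AddCommMonoid P']
    [Module R P'] (f : M →ₗ[R] M') (g : P →ₗ[R] P') (z : M ⊗[R] P) :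
    g.lTensor M' (f.rTensor P z) = f.rTensor P' (g.lTensor M z) := by
  rw [← LinearMap.comp_apply, ← LinearMap.comp_apply, LinearMap.lTensor_comp_rTensor,
    LinearMap.rTensor_comp_lTensor]

variable {k X Y Z : Type u} [Field k] [AddCommGroup X] [Module k X] [Coalgebra k X]
  [AddCommGroup Y] [Module k Y] [AddCommGroup Z] [Module k Z] [Coalgebra k Z]

theorem rTensor_slice_comp [Coalgebra.IsCocomm k X] {a : Y →ₗ[k] Y ⊗[k] X} (ha : IsCoassoc a)
    (ξ : Module.Dual k X) (y : Y) :
    (slice Y ξ ∘ₗ a).rTensor X (a y) = a (slice Y ξ (a y)) := by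
  refine eq_of_slice_eq fun η => ?_
  rw [slice_rTensor, LinearMap.comp_apply, slice_slice_of_isCoassoc ha,
    slice_slice_of_isCoassoc ha, mul_comm]

/-- The largest subcoalgebra on which two linear maps agree, see `isSubcoalgebra_eqSubcoalgebra`,
`eq_of_mem_eqSubcoalgebra` and `mem_eqSubcoalgebra_of_comp_eq`. -/
noncomputable def eqSubcoalgebra (α β : X →ₗ[k] Y) : Submodule k X :=
  LinearMap.eqLocus (α.lTensor X ∘ₗ Coalgebra.comul) (β.lTensor X ∘ₗ Coalgebra.comul)

theorem mem_eqSubcoalgebra {α β : X →ₗ[k] Y} {x : X} : x ∈ eqSubcoalgebra α β ↔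
    α.lTensor X (Coalgebra.comul x) = β.lTensor X (Coalgebra.comul x) := Iff.rfl

theorem isSubcoalgebra_eqSubcoalgebra [Coalgebra.IsCocomm k X] (α β : X →ₗ[k] Y) :
    IsSubcoalgebra k (eqSubcoalgebra α β) := by
  refine isSubcoalgebra_of_slice_mem fun x hx ξ => ?_
  rw [mem_eqSubcoalgebra] at hx ⊢
  rw [← rTensor_slice_comp Coalgebra.coassoc, lTensor_rTensor_comm_apply,
    lTensor_rTensor_comm_apply, hx]

theorem eq_of_mem_eqSubcoalgebra {α β : X →ₗ[k] Y} {x : X} (hx : x ∈ eqSubcoalgebra α β) :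
    α x = β x := by
  have hcounit := congrArg (fun z => TensorProduct.lid k Y (Coalgebra.counit.rTensor Y z))
    (mem_eqSubcoalgebra.1 hx)
  simpa only [← lTensor_rTensor_comm_apply, Coalgebra.rTensor_counit_comul,
    LinearMap.lTensor_tmul, TensorProduct.lid_tmul, one_smul] using hcounit

theorem mem_eqSubcoalgebra_of_comp_eq {α β : X →ₗ[k] Y} (f : Z →ₗc[k] X)
    (h : α ∘ₗ f.toLinearMap = β ∘ₗ f.toLinearMap) (z : Z) : f z ∈ eqSubcoalgebra α β := by
  have hf : Coalgebra.comul (f z) = TensorProduct.map f.toLinearMap f.toLinearMap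
      (Coalgebra.comul z) := (LinearMap.congr_fun f.map_comp_comul z).symm
  rw [mem_eqSubcoalgebra, hf, ← LinearMap.comp_apply, LinearMap.lTensor_comp_map, h,
    ← LinearMap.lTensor_comp_map, LinearMap.comp_apply]

end EqSubcoalgebra

section TensorCoalgebra

variable (R D E : Type*) [CommSemiring R] [AddCommMonoid D] [Module R D] [Coalgebra R D]
  [AddCommMonoid E] [Module R E] [Coalgebra R E]

/-- The projection of the tensor product of coalgebras to the first factor. -/
noncomputable def tensorFst : D ⊗[R] E →ₗc[R] D :=
  (Coalgebra.TensorProduct.rid R R D : D ⊗[R] R →ₗc[R] D).comp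
    (Coalgebra.TensorProduct.map (CoalgHom.id R D) (Coalgebra.counitCoalgHom R E))

/-- The projection of the tensor product of coalgebras to the second factor. -/
noncomputable def tensorSnd : D ⊗[R] E →ₗc[R] E :=
  (Coalgebra.TensorProduct.lid R E : R ⊗[R] E →ₗc[R] E).comp
    (Coalgebra.TensorProduct.map (Coalgebra.counitCoalgHom R D) (CoalgHom.id R E))

variable {R D E}

@[simp]
theorem tensorFst_tmul (d : D) (e : E) :
    tensorFst R D E (d ⊗ₜ e) = Coalgebra.counit (R := R) e • d := rfl

@[simp]
theorem tensorSnd_tmul (d : D) (e : E) :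
    tensorSnd R D E (d ⊗ₜ e) = Coalgebra.counit (R := R) d • e := rfl

variable (R D E) in
theorem comul_tensorProduct : Coalgebra.comul (R := R) (A := D ⊗[R] E) =
    (TensorProduct.AlgebraTensorModule.tensorTensorTensorComm R R R R D D E E).toLinearMap ∘ₗ
      TensorProduct.map Coalgebra.comul Coalgebra.comul := rfl

theorem map_tensorFst_tensorSnd_comul :
    TensorProduct.map (tensorFst R D E).toLinearMap (tensorSnd R D E).toLinearMap ∘ₗ
      Coalgebra.comul = LinearMap.id := by
  have hmap : TensorProduct.map (tensorFst R D E).toLinearMap (tensorSnd R D E).toLinearMap ∘ₗ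
      (TensorProduct.AlgebraTensorModule.tensorTensorTensorComm R R R R D D E E).toLinearMap =
      TensorProduct.map (slice D Coalgebra.counit)
        ((TensorProduct.lid R E).toLinearMap ∘ₗ Coalgebra.counit.rTensor E) := by
    ext d d' e e'
    calc (Coalgebra.counit (R := R) e • d) ⊗ₜ[R] (Coalgebra.counit (R := R) d' • e')
        = (Coalgebra.counit (R := R) d' • d) ⊗ₜ (Coalgebra.counit (R := R) e • e') := by
          rw [TensorProduct.smul_tmul_smul, mul_comm, ← TensorProduct.smul_tmul_smul]
      _ = TensorProduct.map (slice D Coalgebra.counit)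
            ((TensorProduct.lid R E).toLinearMap ∘ₗ Coalgebra.counit.rTensor E)
              ((d ⊗ₜ d') ⊗ₜ (e ⊗ₜ e')) := by simp
  have hcounit : (TensorProduct.lid R E).toLinearMap ∘ₗ Coalgebra.counit.rTensor E ∘ₗ
      Coalgebra.comul = LinearMap.id := by
    ext; simp
  rw [comul_tensorProduct, ← LinearMap.comp_assoc, hmap, ← TensorProduct.map_comp,
    slice_counit_comp_comul, LinearMap.comp_assoc, hcounit, TensorProduct.map_id]

variable {X : Type*} [AddCommMonoid X] [Module R X] [Coalgebra R X] [Coalgebra.IsCocomm R X]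

/-- The coalgebra morphism to a tensor product induced by morphisms to both factors. -/
noncomputable def tensorPair (f : X →ₗc[R] D) (g : X →ₗc[R] E) : X →ₗc[R] D ⊗[R] E :=
  (Coalgebra.TensorProduct.map f g).comp (Coalgebra.comulCoalgHom R X)

theorem tensorPair_toLinearMap (f : X →ₗc[R] D) (g : X →ₗc[R] E) :
    (tensorPair f g).toLinearMap =
      TensorProduct.map f.toLinearMap g.toLinearMap ∘ₗ Coalgebra.comul := rfl

theorem tensorFst_tensorPair (f : X →ₗc[R] D) (g : X →ₗc[R] E) :
    (tensorFst R D E).toLinearMap ∘ₗ (tensorPair f g).toLinearMap = f.toLinearMap := by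
  have hfst : (tensorFst R D E).toLinearMap ∘ₗ TensorProduct.map f.toLinearMap g.toLinearMap =
      f.toLinearMap ∘ₗ slice X Coalgebra.counit := by
    ext; simp
  rw [tensorPair_toLinearMap, ← LinearMap.comp_assoc, hfst, LinearMap.comp_assoc,
    slice_counit_comp_comul, LinearMap.comp_id]

theorem tensorSnd_tensorPair (f : X →ₗc[R] D) (g : X →ₗc[R] E) :
    (tensorSnd R D E).toLinearMap ∘ₗ (tensorPair f g).toLinearMap = g.toLinearMap := by
  have hsnd : (tensorSnd R D E).toLinearMap ∘ₗ TensorProduct.map f.toLinearMap g.toLinearMap =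
      g.toLinearMap ∘ₗ (TensorProduct.lid R X).toLinearMap ∘ₗ Coalgebra.counit.rTensor X := by
    ext; simp
  rw [tensorPair_toLinearMap, ← LinearMap.comp_assoc, hsnd]
  ext x
  simp

omit [Coalgebra.IsCocomm R X] in
theorem tensor_hom_ext {f g : X →ₗc[R] D ⊗[R] E}
    (hfst : (tensorFst R D E).toLinearMap ∘ₗ f.toLinearMap =
      (tensorFst R D E).toLinearMap ∘ₗ g.toLinearMap)
    (hsnd : (tensorSnd R D E).toLinearMap ∘ₗ f.toLinearMap =
      (tensorSnd R D E).toLinearMap ∘ₗ g.toLinearMap) : f = g := by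
  have hrec (h : X →ₗc[R] D ⊗[R] E) : h.toLinearMap =
      TensorProduct.map ((tensorFst R D E).toLinearMap ∘ₗ h.toLinearMap)
        ((tensorSnd R D E).toLinearMap ∘ₗ h.toLinearMap) ∘ₗ Coalgebra.comul := by
    rw [TensorProduct.map_comp, LinearMap.comp_assoc, h.map_comp_comul, ← LinearMap.comp_assoc,
      map_tensorFst_tensorSnd_comul, LinearMap.id_comp]
  have hfg : f.toLinearMap = g.toLinearMap := by rw [hrec f, hfst, hsnd, ← hrec g]
  exact CoalgHom.ext (LinearMap.congr_fun hfg)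

end TensorCoalgebra

section TensorComul

variable {k D E : Type u} [Field k] [AddCommGroup D] [Module k D] [Coalgebra k D]
  [AddCommGroup E] [Module k E] [Coalgebra k E]

theorem lTensor_tensorFst_comul :
    (tensorFst k D E).toLinearMap.lTensor (D ⊗[k] E) ∘ₗ Coalgebra.comul =
      actL (Coalgebra.comul (R := k) (A := D)) E := by
  have hfst : (tensorFst k D E).toLinearMap.lTensor (D ⊗[k] E) ∘ₗ
      (TensorProduct.AlgebraTensorModule.tensorTensorTensorComm k k k k D D E E).toLinearMap =
      (TensorProduct.rightComm k D D E).toLinearMap ∘ₗ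
        (slice E Coalgebra.counit).lTensor (D ⊗[k] D) := by
    ext; simp
  rw [comul_tensorProduct, ← LinearMap.comp_assoc, hfst, LinearMap.comp_assoc,
    LinearMap.lTensor_comp_map, slice_counit_comp_comul]
  rfl

theorem lTensor_tensorSnd_comul :
    (tensorSnd k D E).toLinearMap.lTensor (D ⊗[k] E) ∘ₗ Coalgebra.comul =
      actR D (Coalgebra.comul (R := k) (A := E)) := by
  have hsnd : (tensorSnd k D E).toLinearMap.lTensor (D ⊗[k] E) ∘ₗ
      (TensorProduct.AlgebraTensorModule.tensorTensorTensorComm k k k k D D E E).toLinearMap =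
      (TensorProduct.assoc k D E E).symm.toLinearMap ∘ₗ
        (slice D Coalgebra.counit).rTensor (E ⊗[k] E) := by
    ext; simp [TensorProduct.smul_tmul']
  rw [comul_tensorProduct, ← LinearMap.comp_assoc, hsnd, LinearMap.comp_assoc,
    LinearMap.rTensor_comp_map, slice_counit_comp_comul]
  rfl

end TensorComul

namespace CoalgOver

variable {k C : Type u} [Field k] [AddCommGroup C] [Module k C] [Coalgebra k C]
  [Coalgebra.IsCocomm k C]

instance (φ : CoalgOver k C) : Coalgebra.IsCocomm k φ.left.obj := φ.left.property

/-- The object of `Coalg C` given by a coalgebra morphism. -/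
def ofCoalgHom {D : Type u} [AddCommGroup D] [Module k D] [Coalgebra k D]
    [Coalgebra.IsCocomm k D] (f : D →ₗc[k] C) : CoalgOver k C :=
  Over.mk (Y := Coalg.of k D) (ObjectProperty.homMk (CoalgCat.ofHom f))

/-- The morphism of `Coalg C` given by a coalgebra morphism over `C`. -/
def homMk {φ ψ : CoalgOver k C} (f : φ.left.obj →ₗc[k] ψ.left.obj)
    (h : ψ.str.toLinearMap ∘ₗ f.toLinearMap = φ.str.toLinearMap) : φ ⟶ ψ :=
  Over.homMk (ObjectProperty.homMk (CoalgCat.ofHom f)) <| by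
    apply ObjectProperty.hom_ext
    apply CoalgCat.hom_ext
    exact CoalgHom.ext (LinearMap.congr_fun h)

theorem hom_ext {φ ψ : CoalgOver k C} {f g : φ ⟶ ψ} (h : toCoalgHom f = toCoalgHom g) : f = g := by
  apply Over.OverMorphism.ext
  apply ObjectProperty.hom_ext
  exact CoalgCat.hom_ext _ _ h

/-- The underlying subspace of the product in `Coalg C`, inside the product of cocommutative
coalgebras. -/
noncomputable def prodSpace (φ ψ : CoalgOver k C) :
    Submodule k (φ.left.obj ⊗[k] ψ.left.obj) :=
  eqSubcoalgebra (φ.str.toLinearMap ∘ₗ (tensorFst k φ.left.obj ψ.left.obj).toLinearMap)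
    (ψ.str.toLinearMap ∘ₗ (tensorSnd k φ.left.obj ψ.left.obj).toLinearMap)

theorem isSubcoalgebra_prodSpace (φ ψ : CoalgOver k C) : IsSubcoalgebra k (prodSpace φ ψ) :=
  isSubcoalgebra_eqSubcoalgebra _ _

noncomputable instance (φ ψ : CoalgOver k C) : Coalgebra k (prodSpace φ ψ) :=
  subCoalgebra (isSubcoalgebra_prodSpace φ ψ)

instance (φ ψ : CoalgOver k C) : Coalgebra.IsCocomm k (prodSpace φ ψ) :=
  isCocomm_subCoalgebra (isSubcoalgebra_prodSpace φ ψ)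

/-- The inclusion of the product in the tensor product. -/
noncomputable def prodIncl (φ ψ : CoalgOver k C) :
    prodSpace φ ψ →ₗc[k] φ.left.obj ⊗[k] ψ.left.obj :=
  subCoalgHom (isSubcoalgebra_prodSpace φ ψ)

/-- The product in `Coalg C`. -/
noncomputable def prod (φ ψ : CoalgOver k C) : CoalgOver k C :=
  ofCoalgHom (φ.str.comp ((tensorFst k φ.left.obj ψ.left.obj).comp (prodIncl φ ψ)))

/-- The first projection of the product in `Coalg C`. -/
noncomputable def prodFst (φ ψ : CoalgOver k C) : prod φ ψ ⟶ φ :=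
  homMk ((tensorFst k φ.left.obj ψ.left.obj).comp (prodIncl φ ψ)) rfl

/-- The second projection of the product in `Coalg C`. -/
noncomputable def prodSnd (φ ψ : CoalgOver k C) : prod φ ψ ⟶ ψ :=
  homMk ((tensorSnd k φ.left.obj ψ.left.obj).comp (prodIncl φ ψ)) <|
    LinearMap.ext fun x => (eq_of_mem_eqSubcoalgebra x.2).symm

/-- The morphism to a product in `Coalg C` induced by two morphisms. -/
noncomputable def prodLift {χ φ ψ : CoalgOver k C} (f : χ ⟶ φ) (g : χ ⟶ ψ) : χ ⟶ prod φ ψ :=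
  homMk (subCoalgLift (isSubcoalgebra_prodSpace φ ψ)
    (tensorPair (toCoalgHom f) (toCoalgHom g)) <| mem_eqSubcoalgebra_of_comp_eq _ <| by
      rw [LinearMap.comp_assoc, LinearMap.comp_assoc, tensorFst_tensorPair, tensorSnd_tensorPair,
        CoalgOver.w, CoalgOver.w]) <|
    (congrArg (φ.str.toLinearMap ∘ₗ ·)
      (tensorFst_tensorPair (toCoalgHom f) (toCoalgHom g))).trans (CoalgOver.w f)

theorem prodLift_fst {χ φ ψ : CoalgOver k C} (f : χ ⟶ φ) (g : χ ⟶ ψ) :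
    prodLift f g ≫ prodFst φ ψ = f :=
  hom_ext <| CoalgHom.ext <|
    LinearMap.congr_fun (tensorFst_tensorPair (toCoalgHom f) (toCoalgHom g))

theorem prodLift_snd {χ φ ψ : CoalgOver k C} (f : χ ⟶ φ) (g : χ ⟶ ψ) :
    prodLift f g ≫ prodSnd φ ψ = g :=
  hom_ext <| CoalgHom.ext <|
    LinearMap.congr_fun (tensorSnd_tensorPair (toCoalgHom f) (toCoalgHom g))

theorem prod_hom_ext {χ φ ψ : CoalgOver k C} {f g : χ ⟶ prod φ ψ}
    (hfst : f ≫ prodFst φ ψ = g ≫ prodFst φ ψ) (hsnd : f ≫ prodSnd φ ψ = g ≫ prodSnd φ ψ) :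
    f = g := by
  have hincl : (prodIncl φ ψ).comp (toCoalgHom f) = (prodIncl φ ψ).comp (toCoalgHom g) :=
    tensor_hom_ext (congrArg (fun h => (toCoalgHom h).toLinearMap) hfst)
      (congrArg (fun h => (toCoalgHom h).toLinearMap) hsnd)
  exact hom_ext (CoalgHom.ext fun x => Subtype.ext (DFunLike.congr_fun hincl x))

/-- The universal property of the product in `Coalg C`. -/
noncomputable def prodIsLimit (φ ψ : CoalgOver k C) :
    Limits.IsLimit (Limits.BinaryFan.mk (prodFst φ ψ) (prodSnd φ ψ)) :=
  Limits.BinaryFan.IsLimit.mk _ prodLift prodLift_fst prodLift_snd fun f g _ hf hg =>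
    prod_hom_ext (hf.trans (prodLift_fst f g).symm) (hg.trans (prodLift_snd f g).symm)

noncomputable instance : CartesianMonoidalCategory (CoalgOver k C) :=
  .ofChosenFiniteProducts ⟨_, Over.mkIdTerminal⟩ fun φ ψ => ⟨_, prodIsLimit φ ψ⟩

end CoalgOver

/-! ### The underlying comodule as a strong monoidal functor -/

section Act

variable {k M N C C' : Type u} [Field k] [AddCommGroup M] [Module k M] [AddCommGroup N]
  [Module k N] [AddCommGroup C] [Module k C] [AddCommGroup C'] [Module k C']

theorem lTensor_comp_actL (f : C' →ₗ[k] C) (a : M →ₗ[k] M ⊗[k] C') :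
    f.lTensor (M ⊗[k] N) ∘ₗ actL a N = actL (f.lTensor M ∘ₗ a) N := by
  have hcomm : f.lTensor (M ⊗[k] N) ∘ₗ (TensorProduct.rightComm k M C' N).toLinearMap =
      (TensorProduct.rightComm k M C N).toLinearMap ∘ₗ (f.lTensor M).rTensor N := by
    ext; simp
  rw [actL, actL, LinearMap.rTensor_comp, ← LinearMap.comp_assoc, hcomm, LinearMap.comp_assoc]

theorem lTensor_comp_actR (f : C' →ₗ[k] C) (a : N →ₗ[k] N ⊗[k] C') :
    f.lTensor (M ⊗[k] N) ∘ₗ actR M a = actR M (f.lTensor N ∘ₗ a) := by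
  have hassoc : f.lTensor (M ⊗[k] N) ∘ₗ (TensorProduct.assoc k M N C').symm.toLinearMap =
      (TensorProduct.assoc k M N C).symm.toLinearMap ∘ₗ (f.lTensor N).lTensor M := by
    apply Comod.comp_cancel_right (TensorProduct.assoc k M N C').surjective
    ext; simp
  rw [actR, actR, LinearMap.lTensor_comp, ← LinearMap.comp_assoc, hassoc, LinearMap.comp_assoc]

variable {D : Type u} [AddCommGroup D] [Module k D] [Coalgebra k D]

theorem comul_rTensor_comp_actR (f : D →ₗ[k] C) :
    (Coalgebra.comul (R := k) (A := D)).rTensor C ∘ₗ f.lTensor D ∘ₗ Coalgebra.comul =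
      actR D (f.lTensor D ∘ₗ Coalgebra.comul) ∘ₗ Coalgebra.comul := by
  rw [← lTensor_comp_actR, LinearMap.comp_assoc]
  refine Eq.trans ?_ (congrArg (f.lTensor (D ⊗[k] D) ∘ₗ ·) (Comod.coact_actR (Comod.unit k D)))
  rw [← LinearMap.comp_assoc, LinearMap.rTensor_comp_lTensor, ← LinearMap.lTensor_comp_rTensor,
    LinearMap.comp_assoc]
  rfl

theorem comul_rTensor_comp_actL [Coalgebra.IsCocomm k D] (f : D →ₗ[k] C) :
    (Coalgebra.comul (R := k) (A := D)).rTensor C ∘ₗ f.lTensor D ∘ₗ Coalgebra.comul =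
      actL (f.lTensor D ∘ₗ Coalgebra.comul) D ∘ₗ Coalgebra.comul := by
  rw [← lTensor_comp_actL, LinearMap.comp_assoc]
  refine Eq.trans ?_ (congrArg (f.lTensor (D ⊗[k] D) ∘ₗ ·) (Comod.coact_actL (Comod.unit k D)))
  rw [← LinearMap.comp_assoc, LinearMap.rTensor_comp_lTensor, ← LinearMap.lTensor_comp_rTensor,
    LinearMap.comp_assoc]
  rfl

end Act

variable {k C : Type u} [Field k] [AddCommGroup C] [Module k C] [Coalgebra k C]

namespace Comod

theorem isIso_of_bijective {V W : Comod k C} (f : V ⟶ W) (hf : Function.Bijective f.lin) :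
    IsIso f := by
  let e := LinearEquiv.ofBijective f.lin hf
  have he : e.toLinearMap = f.lin := rfl
  refine ⟨⟨e.symm.toLinearMap, ?_⟩, Comod.hom_ext (LinearEquiv.symm_comp e),
    Comod.hom_ext (LinearEquiv.comp_symm e)⟩
  apply comp_cancel_right e.surjective
  rw [he, LinearMap.comp_assoc, LinearMap.comp_assoc, ← f.colinear, ← LinearMap.comp_assoc,
    ← LinearMap.rTensor_comp, ← he, LinearEquiv.symm_comp, LinearMap.rTensor_id,
    LinearMap.id_comp, LinearMap.comp_id]

variable [Coalgebra.IsCocomm k C]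

theorem embL_whiskerRight {V W Z : Comod k C} (f : Z ⟶ V ⊗ W) (X : Comod k C) :
    embL V W X ∘ₗ (f ▷ X).lin = (TensorProduct.assoc k V W X).toLinearMap ∘ₗ
      (incl V W ∘ₗ f.lin).rTensor X ∘ₗ incl Z X := by
  rw [embL, LinearMap.comp_assoc, LinearMap.comp_assoc]
  refine congrArg ((TensorProduct.assoc k V W X).toLinearMap ∘ₗ ·) ?_
  refine (congrArg ((incl V W).rTensor X ∘ₗ ·) (incl_cotensorHom f (𝟙 X))).trans ?_
  rw [← LinearMap.comp_assoc, LinearMap.rTensor_comp_map]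
  rfl

theorem embR_whiskerLeft {W X Z : Comod k C} (V : Comod k C) (f : Z ⟶ W ⊗ X) :
    embR V W X ∘ₗ (V ◁ f).lin = (incl W X ∘ₗ f.lin).lTensor V ∘ₗ incl V Z := by
  rw [embR, LinearMap.comp_assoc]
  refine (congrArg ((incl W X).lTensor V ∘ₗ ·) (incl_cotensorHom (𝟙 V) f)).trans ?_
  rw [← LinearMap.comp_assoc, LinearMap.lTensor_comp_map]
  rfl

end Comod

variable [Coalgebra.IsCocomm k C]

open Comod CoalgOver SemiCartesianMonoidalCategory CartesianMonoidalCategory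

theorem cotensorSpace_U (φ ψ : CoalgOver k C) :
    cotensorSpace ((U k C).obj φ) ((U k C).obj ψ) = prodSpace φ ψ := by
  rw [cotensorSpace_eq, prodSpace, eqSubcoalgebra, LinearMap.lTensor_comp, LinearMap.lTensor_comp,
    LinearMap.comp_assoc, LinearMap.comp_assoc, lTensor_tensorFst_comul, lTensor_tensorSnd_comul,
    lTensor_comp_actL, lTensor_comp_actR]
  rfl

/-- The comultiplication of `D` as a morphism `U D ⟶ U D ⊗^C U D`. -/
noncomputable def diagU (φ : CoalgOver k C) :
    (U k C).obj φ ⟶ (U k C).obj φ ⊗ (U k C).obj φ :=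
  Comod.lift (Coalgebra.comul (R := k) (A := φ.left.obj))
    (comul_rTensor_comp_actL φ.str.toLinearMap) (comul_rTensor_comp_actR φ.str.toLinearMap)

theorem incl_diagU (φ : CoalgOver k C) :
    incl _ _ ∘ₗ (diagU φ).lin = Coalgebra.comul (R := k) (A := φ.left.obj) :=
  incl_lift _ _ _

theorem diagU_natural {φ ψ : CoalgOver k C} (f : φ ⟶ ψ) :
    (U k C).map f ≫ diagU ψ = diagU φ ≫ ((U k C).map f ⊗ₘ (U k C).map f) :=
  hom_ext_incl (toCoalgHom f).map_comp_comul.symm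

theorem diagU_assoc (φ : CoalgOver k C) :
    diagU φ ≫ (diagU φ ▷ (U k C).obj φ) ≫ (α_ _ _ _).hom =
      diagU φ ≫ ((U k C).obj φ ◁ diagU φ) := by
  apply Comod.hom_ext
  apply comp_cancel (embR_injective _ _ _)
  let Δ := Coalgebra.comul (R := k) (A := φ.left.obj)
  have hleft : embR _ _ _ ∘ₗ (diagU φ ≫ (diagU φ ▷ (U k C).obj φ) ≫ (α_ _ _ _).hom).lin =
      (TensorProduct.assoc k φ.left.obj φ.left.obj φ.left.obj).toLinearMap ∘ₗ
        Δ.rTensor φ.left.obj ∘ₗ Δ := by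
    refine (congrArg (· ∘ₗ (diagU φ ▷ (U k C).obj φ).lin ∘ₗ (diagU φ).lin)
      (embR_assocHom _ _ _)).trans ?_
    rw [← LinearMap.comp_assoc, embL_whiskerRight, incl_diagU]
    rfl
  have hright : embR _ _ _ ∘ₗ (diagU φ ≫ ((U k C).obj φ ◁ diagU φ)).lin =
      Δ.lTensor φ.left.obj ∘ₗ Δ := by
    rw [comp_lin, ← LinearMap.comp_assoc, embR_whiskerLeft, incl_diagU]
    rfl
  exact hleft.trans (Coalgebra.coassoc.trans hright.symm)

/-- The structure morphism of `φ` as a morphism from `U φ` to the unit. -/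
noncomputable def counitU (φ : CoalgOver k C) : (U k C).obj φ ⟶ 𝟙_ (Comod k C) where
  lin := φ.str.toLinearMap
  colinear := by
    refine Eq.trans ?_ φ.str.map_comp_comul
    rw [← LinearMap.rTensor_comp_lTensor, LinearMap.comp_assoc]
    rfl

theorem map_counitU {φ ψ : CoalgOver k C} (f : φ ⟶ ψ) : (U k C).map f ≫ counitU ψ = counitU φ :=
  Comod.hom_ext (CoalgOver.w f)

theorem diagU_counitU_right (φ : CoalgOver k C) :
    diagU φ ≫ ((U k C).obj φ ◁ counitU φ) = (ρ_ ((U k C).obj φ)).inv :=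
  hom_ext_incl rfl

theorem diagU_braiding (φ : CoalgOver k C) : diagU φ ≫ (β_ _ _).hom = diagU φ :=
  hom_ext_incl (Coalgebra.comm_comp_comul k φ.left.obj)

theorem diagU_counitU_left (φ : CoalgOver k C) :
    diagU φ ≫ (counitU φ ▷ (U k C).obj φ) = (λ_ ((U k C).obj φ)).inv := by
  rw [← diagU_braiding, Category.assoc, ← BraidedCategory.braiding_naturality_right,
    ← Category.assoc, diagU_counitU_right]
  rfl

/-- The morphism `U χ ⟶ U φ ⊗^C U ψ` induced by a pair of morphisms. -/
noncomputable def pairU {χ φ ψ : CoalgOver k C} (f : χ ⟶ φ) (g : χ ⟶ ψ) :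
    (U k C).obj χ ⟶ (U k C).obj φ ⊗ (U k C).obj ψ :=
  diagU χ ≫ ((U k C).map f ⊗ₘ (U k C).map g)

theorem map_pairU {ω χ φ ψ : CoalgOver k C} (h : ω ⟶ χ) (f : χ ⟶ φ) (g : χ ⟶ ψ) :
    (U k C).map h ≫ pairU f g = pairU (h ≫ f) (h ≫ g) := by
  rw [pairU, ← Category.assoc, diagU_natural, Category.assoc, tensorHom_comp_tensorHom, pairU,
    Functor.map_comp, Functor.map_comp]

theorem pairU_tensorHom {χ φ ψ : CoalgOver k C} (f : χ ⟶ φ) (g : χ ⟶ ψ) {V W : Comod k C}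
    (a : (U k C).obj φ ⟶ V) (b : (U k C).obj ψ ⟶ W) :
    pairU f g ≫ (a ⊗ₘ b) = diagU χ ≫ ((U k C).map f ≫ a ⊗ₘ (U k C).map g ≫ b) := by
  rw [pairU, Category.assoc, tensorHom_comp_tensorHom]

theorem pairU_map_tensorHom_map {χ φ ψ φ' ψ' : CoalgOver k C} (f : χ ⟶ φ) (g : χ ⟶ ψ)
    (a : φ ⟶ φ') (b : ψ ⟶ ψ') :
    pairU f g ≫ ((U k C).map a ⊗ₘ (U k C).map b) = pairU (f ≫ a) (g ≫ b) := by
  rw [pairU_tensorHom, pairU, Functor.map_comp, Functor.map_comp]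

theorem pairU_assoc {χ φ ψ ω : CoalgOver k C} (f : χ ⟶ φ) (g : χ ⟶ ψ) (h : χ ⟶ ω) :
    diagU χ ≫ (pairU f g ⊗ₘ (U k C).map h) ≫ (α_ _ _ _).hom =
      diagU χ ≫ ((U k C).map f ⊗ₘ pairU g h) := by
  have hleft : pairU f g ⊗ₘ (U k C).map h = (diagU χ ▷ _) ≫
      (((U k C).map f ⊗ₘ (U k C).map g) ⊗ₘ (U k C).map h) := by
    rw [← tensorHom_id, tensorHom_comp_tensorHom, Category.id_comp, pairU]
  have hright : (U k C).map f ⊗ₘ pairU g h = (_ ◁ diagU χ) ≫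
      ((U k C).map f ⊗ₘ ((U k C).map g ⊗ₘ (U k C).map h)) := by
    rw [← id_tensorHom, tensorHom_comp_tensorHom, Category.id_comp, pairU]
  rw [hleft, hright, Category.assoc, associator_naturality, ← Category.assoc, ← Category.assoc,
    Category.assoc (diagU χ), diagU_assoc, Category.assoc]

noncomputable instance : (U k C).OplaxMonoidal where
  η := counitU _
  δ φ ψ := pairU (fst φ ψ) (snd φ ψ)
  δ_natural_left f ψ := by
    rw [map_pairU, ← tensorHom_id, ← CategoryTheory.Functor.map_id, pairU_map_tensorHom_map]
    simp
  δ_natural_right φ f := by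
    rw [map_pairU, ← id_tensorHom, ← CategoryTheory.Functor.map_id, pairU_map_tensorHom_map]
    simp
  oplax_associativity φ ψ χ := by
    rw [← Category.assoc ((U k C).map _), map_pairU, ← tensorHom_id, ← id_tensorHom,
      ← Category.assoc, pairU_tensorHom, pairU_tensorHom, map_pairU, map_pairU, Category.comp_id,
      Category.comp_id, Category.assoc, pairU_assoc]
    simp
  oplax_left_unitality φ := by
    rw [← Category.assoc, map_pairU, ← tensorHom_id, pairU_tensorHom, map_counitU,
      leftUnitor_inv_snd, CategoryTheory.Functor.map_id, Category.comp_id, tensorHom_id,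
      diagU_counitU_left]
  oplax_right_unitality φ := by
    rw [← Category.assoc, map_pairU, ← id_tensorHom, pairU_tensorHom, map_counitU,
      rightUnitor_inv_fst, CategoryTheory.Functor.map_id, Category.comp_id, id_tensorHom,
      diagU_counitU_right]

instance : IsIso (Functor.OplaxMonoidal.η (U k C)) :=
  isIso_of_bijective _ (Function.bijective_id : Function.Bijective (id : C → C))

theorem incl_δ_apply (φ ψ : CoalgOver k C) (t : prodSpace φ ψ) :
    incl _ _ ((Functor.OplaxMonoidal.δ (U k C) φ ψ).lin t) =
      (t : φ.left.obj ⊗[k] ψ.left.obj) := by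
  let fst' := tensorFst k φ.left.obj ψ.left.obj
  let snd' := tensorSnd k φ.left.obj ψ.left.obj
  calc TensorProduct.map (fst'.toLinearMap ∘ₗ (prodIncl φ ψ).toLinearMap)
        (snd'.toLinearMap ∘ₗ (prodIncl φ ψ).toLinearMap) (Coalgebra.comul t)
      = TensorProduct.map fst'.toLinearMap snd'.toLinearMap
          (TensorProduct.map (prodIncl φ ψ).toLinearMap (prodIncl φ ψ).toLinearMap
            (Coalgebra.comul t)) := LinearMap.congr_fun (TensorProduct.map_comp _ _ _ _) _
    _ = TensorProduct.map fst'.toLinearMap snd'.toLinearMap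
          (Coalgebra.comul (prodIncl φ ψ t)) :=
        congrArg _ (LinearMap.congr_fun (prodIncl φ ψ).map_comp_comul t)
    _ = prodIncl φ ψ t := LinearMap.congr_fun map_tensorFst_tensorSnd_comul _

instance (φ ψ : CoalgOver k C) : IsIso (Functor.OplaxMonoidal.δ (U k C) φ ψ) := by
  refine isIso_of_bijective _ ⟨fun s t h => ?_, fun t => ?_⟩
  · apply Subtype.ext
    rw [← incl_δ_apply φ ψ s, ← incl_δ_apply φ ψ t]
    exact congrArg _ h
  · refine ⟨⟨t.1, ?_⟩, incl_injective _ _ (incl_δ_apply φ ψ _)⟩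
    rw [← cotensorSpace_U]
    exact t.2

noncomputable instance : (U k C).Monoidal := .ofOplaxMonoidal _

/-! ### The right adjoint -/

section ArrowPair

variable {k C : Type u} [Field k] [AddCommGroup C] [Module k C] [Coalgebra k C]
  {X Y : Type u} [AddCommGroup X] [Module k X] [Coalgebra k X]
  [AddCommGroup Y] [Module k Y] [Coalgebra k Y] {W : Comod k C}

/-- The two components of `q` are a coalgebra morphism `X → C` and a colinear map to `W` from the
resulting comodule `X`, that is, `q` amounts to an arrow from an object of `Coalg C` to `W`. -/
structure IsArrowPair (W : Comod k C) (q : X →ₗ[k] C × W) : Prop where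
  counit_comp : Coalgebra.counit ∘ₗ LinearMap.fst k C W ∘ₗ q = Coalgebra.counit
  map_comp_comul : TensorProduct.map (LinearMap.fst k C W ∘ₗ q) (LinearMap.fst k C W ∘ₗ q) ∘ₗ
    Coalgebra.comul = Coalgebra.comul ∘ₗ LinearMap.fst k C W ∘ₗ q
  map_comp_coact : TensorProduct.map (LinearMap.snd k C W ∘ₗ q) (LinearMap.fst k C W ∘ₗ q) ∘ₗ
    Coalgebra.comul = W.coact ∘ₗ LinearMap.snd k C W ∘ₗ q

theorem map_comp_comul_comp {A B : Type u} [AddCommGroup A] [Module k A] [AddCommGroup B]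
    [Module k B] (a : X →ₗ[k] A) (b : X →ₗ[k] B) (f : Y →ₗc[k] X) :
    (TensorProduct.map a b ∘ₗ Coalgebra.comul) ∘ₗ f.toLinearMap =
      TensorProduct.map (a ∘ₗ f.toLinearMap) (b ∘ₗ f.toLinearMap) ∘ₗ Coalgebra.comul := by
  rw [TensorProduct.map_comp, LinearMap.comp_assoc, LinearMap.comp_assoc, f.map_comp_comul]

theorem rTensor_comp_lTensor_comp_comul {A B : Type u} [AddCommGroup A] [Module k A]
    [AddCommGroup B] [Module k B] (a : X →ₗ[k] A) (b : X →ₗ[k] B) :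
    a.rTensor B ∘ₗ b.lTensor X ∘ₗ Coalgebra.comul = TensorProduct.map a b ∘ₗ Coalgebra.comul := by
  rw [← LinearMap.comp_assoc, LinearMap.rTensor_comp_lTensor]

theorem IsArrowPair.comp {q : X →ₗ[k] C × W} (hq : IsArrowPair W q) (f : Y →ₗc[k] X) :
    IsArrowPair W (q ∘ₗ f.toLinearMap) where
  counit_comp := by
    rw [← LinearMap.comp_assoc, ← LinearMap.comp_assoc, LinearMap.comp_assoc _ _ Coalgebra.counit,
      hq.counit_comp, f.counit_comp]
  map_comp_comul := by
    rw [← LinearMap.comp_assoc, ← map_comp_comul_comp, hq.map_comp_comul, LinearMap.comp_assoc]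
  map_comp_coact := by
    rw [← LinearMap.comp_assoc, ← LinearMap.comp_assoc, ← map_comp_comul_comp, hq.map_comp_coact,
      LinearMap.comp_assoc]

theorem linearMap_ext_of_iSup_range_eq_top {R M N ι : Type*} {P : ι → Type*} [Semiring R]
    [AddCommMonoid M] [Module R M] [AddCommMonoid N] [Module R N] [∀ i, AddCommMonoid (P i)]
    [∀ i, Module R (P i)] {f : ∀ i, P i →ₗ[R] M} (hf : ⨆ i, LinearMap.range (f i) = ⊤)
    {a b : M →ₗ[R] N} (h : ∀ i, a ∘ₗ f i = b ∘ₗ f i) : a = b := by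
  have hle : ⨆ i, LinearMap.range (f i) ≤ LinearMap.eqLocus a b := by
    refine iSup_le fun i => ?_
    rintro _ ⟨x, rfl⟩
    exact LinearMap.congr_fun (h i) x
  exact LinearMap.ext fun x => hle (hf ▸ Submodule.mem_top)

theorem IsArrowPair.of_iSup_range_eq_top {ι : Type*} {Y : ι → Type u} [∀ i, AddCommGroup (Y i)]
    [∀ i, Module k (Y i)] [∀ i, Coalgebra k (Y i)] {f : ∀ i, Y i →ₗc[k] X}
    (hf : ⨆ i, LinearMap.range (f i).toLinearMap = ⊤) {q : X →ₗ[k] C × W}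
    (hq : ∀ i, IsArrowPair W (q ∘ₗ (f i).toLinearMap)) : IsArrowPair W q where
  counit_comp := linearMap_ext_of_iSup_range_eq_top hf fun i =>
    (hq i).counit_comp.trans (f i).counit_comp.symm
  map_comp_comul := linearMap_ext_of_iSup_range_eq_top hf fun i =>
    (map_comp_comul_comp _ _ (f i)).trans (hq i).map_comp_comul
  map_comp_coact := linearMap_ext_of_iSup_range_eq_top hf fun i =>
    (map_comp_comul_comp _ _ (f i)).trans (hq i).map_comp_coact

/-- The coalgebra morphism to `C` underlying an arrow pair. -/
def IsArrowPair.coalgHom {q : X →ₗ[k] C × W} (hq : IsArrowPair W q) : X →ₗc[k] C :=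
  { LinearMap.fst k C W ∘ₗ q with
    counit_comp := hq.counit_comp
    map_comp_comul := hq.map_comp_comul }

variable [Coalgebra.IsCocomm k C] [Coalgebra.IsCocomm k X]

/-- The arrow from an object of `Coalg C` to `W` given by an arrow pair. -/
noncomputable def IsArrowPair.arrow {q : X →ₗ[k] C × W} (hq : IsArrowPair W q) :
    CostructuredArrow (U k C) W :=
  CostructuredArrow.mk (Y := CoalgOver.ofCoalgHom hq.coalgHom)
    { lin := LinearMap.snd k C W ∘ₗ q
      colinear := (rTensor_comp_lTensor_comp_comul (LinearMap.snd k C W ∘ₗ q)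
        (LinearMap.fst k C W ∘ₗ q)).trans hq.map_comp_coact }

/-- The pair of maps underlying an arrow from an object of `Coalg C` to `W`. -/
noncomputable def arrowPair (A : CostructuredArrow (U k C) W) : A.left.left.obj →ₗ[k] C × W :=
  A.left.str.toLinearMap.prod A.hom.lin

theorem isArrowPair_arrowPair (A : CostructuredArrow (U k C) W) :
    IsArrowPair W (arrowPair A) where
  counit_comp := A.left.str.counit_comp
  map_comp_comul := A.left.str.map_comp_comul
  map_comp_coact :=
    (rTensor_comp_lTensor_comp_comul (LinearMap.snd k C W ∘ₗ arrowPair A)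
      (LinearMap.fst k C W ∘ₗ arrowPair A)).symm.trans A.hom.colinear

theorem arrowPair_comp_left {A B : CostructuredArrow (U k C) W} (f : A ⟶ B) :
    arrowPair B ∘ₗ (CoalgOver.toCoalgHom f.left).toLinearMap = arrowPair A :=
  LinearMap.ext fun x => Prod.ext (LinearMap.congr_fun (CoalgOver.w f.left) x)
    (LinearMap.congr_fun (congrArg Comod.Hom.lin (CostructuredArrow.w f)) x)

/-- The morphism of arrows to `W` given by a coalgebra morphism compatible with the pairs. -/
noncomputable def arrowHomMk {A B : CostructuredArrow (U k C) W}
    (g : A.left.left.obj →ₗc[k] B.left.left.obj)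
    (hg : arrowPair B ∘ₗ g.toLinearMap = arrowPair A) : A ⟶ B :=
  CostructuredArrow.homMk
    (CoalgOver.homMk g (congrArg (LinearMap.fst k C W ∘ₗ ·) hg))
    (Comod.hom_ext (congrArg (LinearMap.snd k C W ∘ₗ ·) hg))

end ArrowPair

section Amalgam

variable {R V ι : Type*} {A : ι → Type*} [DecidableEq ι] [CommRing R] [∀ i, AddCommGroup (A i)]
  [∀ i, Module R (A i)] [∀ i, Coalgebra R (A i)] [AddCommGroup V] [Module R V]

/-- The quotient of the direct sum of a family of coalgebras `A i` with linear maps to `V` by the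
largest coideal on which the induced linear map to `V` vanishes. -/
abbrev Amalgam (q : ∀ i, A i →ₗ[R] V) : Type _ :=
  (Π₀ i, A i) ⧸ maxCoideal (DFinsupp.lsum R q)

/-- The linear map to `V` on the amalgam of a family. -/
noncomputable abbrev amalgamMap (q : ∀ i, A i →ₗ[R] V) : Amalgam q →ₗ[R] V :=
  maxQuotMap (DFinsupp.lsum R q)

/-- The morphism from a member of a family of coalgebras to the direct sum. -/
def lsingleCoalgHom (R : Type*) {ι : Type*} (A : ι → Type*) [DecidableEq ι] [CommRing R]
    [∀ i, AddCommGroup (A i)] [∀ i, Module R (A i)] [∀ i, Coalgebra R (A i)] (i : ι) :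
    A i →ₗc[R] Π₀ i, A i :=
  { DFinsupp.lsingle i with
    counit_comp := DFinsupp.counit_comp_lsingle R ι A i
    map_comp_comul := (DFinsupp.comul_comp_lsingle R ι A i).symm }

/-- The morphism from a member of a family of coalgebras to the amalgam. -/
noncomputable def toAmalgam (q : ∀ i, A i →ₗ[R] V) (i : ι) : A i →ₗc[R] Amalgam q :=
  (Coalgebra.Quotient.mkQCoalgHom (maxCoideal (DFinsupp.lsum R q))).comp (lsingleCoalgHom R A i)

theorem amalgamMap_comp_toAmalgam (q : ∀ i, A i →ₗ[R] V) (i : ι) :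
    amalgamMap q ∘ₗ (toAmalgam q i).toLinearMap = q i :=
  LinearMap.ext fun x => DFinsupp.lsum_single R q i x

theorem iSup_range_toAmalgam (q : ∀ i, A i →ₗ[R] V) :
    ⨆ i, LinearMap.range (toAmalgam q i).toLinearMap = ⊤ := by
  calc ⨆ i, LinearMap.range (toAmalgam q i).toLinearMap
      = (⨆ i, LinearMap.range (DFinsupp.lsingle i)).map (maxCoideal (DFinsupp.lsum R q)).mkQ := by
        rw [Submodule.map_iSup]
        exact iSup_congr fun i => LinearMap.range_comp (DFinsupp.lsingle i) _
    _ = ⊤ := by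
        rw [DFinsupp.iSup_range_lsingle, Submodule.map_top, Submodule.range_mkQ]

end Amalgam

theorem isArrowPair_amalgamMap {k C ι : Type u} {A : ι → Type u} [Field k] [AddCommGroup C]
    [Module k C] [Coalgebra k C] [DecidableEq ι] [∀ i, AddCommGroup (A i)] [∀ i, Module k (A i)]
    [∀ i, Coalgebra k (A i)] {W : Comod k C} {q : ∀ i, A i →ₗ[k] C × W}
    (hq : ∀ i, IsArrowPair W (q i)) : IsArrowPair W (amalgamMap q) := by
  refine .of_iSup_range_eq_top (iSup_range_toAmalgam q) fun i => ?_
  rw [amalgamMap_comp_toAmalgam]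
  exact hq i

section SmallArrow

variable {k C B : Type u} [Field k] [AddCommGroup C] [Module k C] [Coalgebra k C]
  [AddCommGroup B] [Module k B] {W : Comod k C}

/-- An arrow to `W` from a cocommutative coalgebra over `C` carried by a subspace of `B`. Unlike
all the arrows to `W`, these form a small type. -/
structure SmallArrow (B : Type u) [AddCommGroup B] [Module k B] (W : Comod k C) where
  space : Submodule k B
  [coalgebra : Coalgebra k space]
  [isCocomm : Coalgebra.IsCocomm k space]
  pair : space →ₗ[k] C × W
  isArrowPair : IsArrowPair W pair

attribute [instance] SmallArrow.coalgebra SmallArrow.isCocomm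

theorem exists_coalgEquiv_of_linearEquiv {R E N : Type*} [CommRing R] [AddCommGroup E]
    [Module R E] [Coalgebra R E] [Module.Flat R E] [AddCommGroup N] [Module R N] [Module.Flat R N]
    (e : E ≃ₗ[R] N) : ∃ _ : Coalgebra R N, Nonempty (N ≃ₗc[R] E) := by
  let Δ : N →ₗ[R] N ⊗[R] N :=
    TensorProduct.map e.toLinearMap e.toLinearMap ∘ₗ Coalgebra.comul ∘ₗ e.symm.toLinearMap
  have hΔ : TensorProduct.map e.symm.toLinearMap e.symm.toLinearMap ∘ₗ Δ =
      Coalgebra.comul ∘ₗ e.symm.toLinearMap := by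
    rw [← LinearMap.comp_assoc, ← TensorProduct.map_comp, LinearEquiv.symm_comp,
      TensorProduct.map_id, LinearMap.id_comp]
  let _ := coalgebraOfInjective e.symm.toLinearMap e.symm.injective Δ hΔ
  let ι : N →ₗc[R] E := { e.symm.toLinearMap with counit_comp := rfl, map_comp_comul := hΔ }
  exact ⟨_, ⟨CoalgEquiv.ofBijective (f := ι) e.symm.bijective⟩⟩

theorem exists_smallArrow {E : Type u} [AddCommGroup E] [Module k E] [Coalgebra k E]
    [Coalgebra.IsCocomm k E] {j : E →ₗ[k] B} (hj : Function.Injective j) {p : E →ₗ[k] C × W}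
    (hp : IsArrowPair W p) :
    ∃ (i : SmallArrow B W) (g : E →ₗc[k] i.space), i.pair ∘ₗ g.toLinearMap = p := by
  obtain ⟨_, ⟨g⟩⟩ := exists_coalgEquiv_of_linearEquiv (LinearEquiv.ofInjective j hj)
  let ι : LinearMap.range j →ₗc[k] E := g
  have := isCocomm_of_injective ι g.toLinearEquiv.injective
  exact ⟨⟨LinearMap.range j, p ∘ₗ ι.toLinearMap, hp.comp ι⟩, g.symm,
    LinearMap.ext fun x => congrArg p (g.apply_symm_apply x)⟩

variable (B W)

noncomputable instance : DecidableEq (SmallArrow B W) := Classical.decEq _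

/-- The amalgam of all small arrows to `W`. For `B = ℕ →₀ k` it is the coalgebra underlying the
value at `W` of the right adjoint of `U`. -/
abbrev Cofree : Type u := Amalgam (SmallArrow.pair (B := B) (W := W))

/-- The pair of maps on the amalgam of all small arrows to `W`. -/
noncomputable abbrev cofreePair : Cofree B W →ₗ[k] C × W :=
  amalgamMap (SmallArrow.pair (B := B) (W := W))

theorem isArrowPair_cofreePair : IsArrowPair W (cofreePair B W) :=
  isArrowPair_amalgamMap SmallArrow.isArrowPair

end SmallArrow

section Terminal

theorem exists_injective_finsupp_nat (k E : Type*) [Field k] [AddCommGroup E] [Module k E]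
    [FiniteDimensional k E] : ∃ j : E →ₗ[k] ℕ →₀ k, Function.Injective j :=
  ⟨Finsupp.lmapDomain k k Fin.val ∘ₗ (Module.finBasis k E).repr.toLinearMap,
    (Finsupp.mapDomain_injective Fin.val_injective).comp (Module.finBasis k E).repr.injective⟩

variable {k C : Type u} [Field k] [AddCommGroup C] [Module k C] [Coalgebra k C] {W : Comod k C}

/-- Every element of `X` lies in a finite-dimensional subcoalgebra, which is a small arrow. -/
theorem IsArrowPair.exists_coalgHom_cofree {X : Type u} [AddCommGroup X] [Module k X]
    [Coalgebra k X] [Coalgebra.IsCocomm k X] {p : X →ₗ[k] C × W} (hp : IsArrowPair W p) :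
    ∃ g : X →ₗc[k] Cofree (ℕ →₀ k) W, cofreePair (ℕ →₀ k) W ∘ₗ g.toLinearMap = p := by
  refine exists_coalgHom_comp_eq (maxCoideal_maxQuotMap _) fun x => ?_
  obtain ⟨N, hN, _, hx⟩ := exists_finiteDimensional_subcoalgebra (k := k) x
  let _ := subCoalgebra hN
  have := isCocomm_subCoalgebra hN
  obtain ⟨j, hj⟩ := exists_injective_finsupp_nat k N
  obtain ⟨i, g, hg⟩ := exists_smallArrow hj (hp.comp (subCoalgHom hN))
  refine ⟨toAmalgam SmallArrow.pair i (g ⟨x, hx⟩),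
    mk_neg_mem_maxCoideal_coprod (subCoalgHom hN) ((toAmalgam SmallArrow.pair i).comp g) ?_ ⟨x, hx⟩⟩
  exact (congrArg (· ∘ₗ g.toLinearMap) (amalgamMap_comp_toAmalgam SmallArrow.pair i)).trans hg

variable [Coalgebra.IsCocomm k C]

instance (B : Type u) [AddCommGroup B] [Module k B] : Coalgebra.IsCocomm k (Cofree B W) :=
  isCocomm_quotient _

variable (W)

instance hasTerminal_costructuredArrow_U :
    Limits.HasTerminal (CostructuredArrow (U k C) W) := by
  let T := (isArrowPair_cofreePair (ℕ →₀ k) W).arrow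
  have hunique (A : CostructuredArrow (U k C) W) (f g : A ⟶ T) : f = g :=
    CostructuredArrow.hom_ext _ _ <| CoalgOver.hom_ext <|
      coalgHom_ext_of_maxCoideal_eq_bot (maxCoideal_maxQuotMap _)
        ((arrowPair_comp_left f).trans (arrowPair_comp_left g).symm)
  have hexists (A : CostructuredArrow (U k C) W) : Nonempty (A ⟶ T) := by
    obtain ⟨g, hg⟩ := (isArrowPair_arrowPair A).exists_coalgHom_cofree
    exact ⟨arrowHomMk g hg⟩
  exact (Limits.IsTerminal.ofUniqueHom (fun A => (hexists A).some)
    fun A f => hunique A f _).hasTerminal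

end Terminal

/-! ### Comodules over a cosemisimple coalgebra -/

section Semisimple

variable {k : Type u} [Field k] {C : Type u} [AddCommGroup C] [Module k C] [Coalgebra k C]

namespace Comod

/-- The space `M ⊗ V` with the coaction of `V`. For `V = C` it is the cofree comodule on `M`. -/
noncomputable def free (M : Type u) [AddCommGroup M] [Module k M] (V : Comod k C) :
    Comod k C where
  carrier := M ⊗[k] V
  coact := actR M V.coact
  coassoc := isCoassoc_actR V.coassoc
  counital := isCounital_actR V.counital

/-- The coaction of `V` as a morphism to the cofree comodule `V ⊗ C`. -/
noncomputable def coactHom (V : Comod k C) : V ⟶ free V (unit k C) where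
  lin := V.coact
  colinear := coact_actR V

/-- The map `x ↦ m ⊗ x` as a morphism `V ⟶ M ⊗ V`. -/
noncomputable def freeMk {M : Type u} [AddCommGroup M] [Module k M] (m : M) (V : Comod k C) :
    V ⟶ free M V where
  lin := TensorProduct.mk k M V m
  colinear := by
    have h : (TensorProduct.mk k M V m).rTensor C =
        (TensorProduct.assoc k M V C).symm.toLinearMap ∘ₗ TensorProduct.mk k M (V ⊗[k] C) m := by
      ext; simp
    exact congrArg (· ∘ₗ V.coact) h

/-- The dual of `C` as an algebra under convolution; every comodule is a module over it. -/
abbrev ConvDual (k C : Type u) [Field k] [AddCommGroup C] [Module k C] : Type u :=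
  WithConv (Module.Dual k C)

noncomputable instance (V : Comod k C) : Module (ConvDual k C) V where
  smul ξ x := slice V ξ.ofConv (V.coact x)
  one_smul x := LinearMap.congr_fun (evC_coact V) x
  mul_smul η ξ x := (slice_slice_of_isCoassoc V.coassoc ξ.ofConv η.ofConv x).symm
  smul_zero ξ := by change slice V _ (V.coact 0) = 0; simp
  smul_add ξ x y := by change slice V _ (V.coact (x + y)) = slice V _ _ + slice V _ _; simp
  add_smul ξ η x := by change slice V (ξ + η).ofConv _ = slice V _ _ + slice V _ _; simp
  zero_smul x := by change slice V (0 : ConvDual k C).ofConv _ = 0; simp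

theorem smul_eq_slice {V : Comod k C} (ξ : ConvDual k C) (x : V) :
    ξ • x = slice V ξ.ofConv (V.coact x) :=
  rfl

instance (V : Comod k C) : IsScalarTower k (ConvDual k C) V where
  smul_assoc r ξ x := by
    simp only [smul_eq_slice, WithConv.ofConv_smul, map_smul, LinearMap.smul_apply]

/-- A morphism of comodules as a linear map over the dual algebra. -/
def Hom.toConvDualLinear {V W : Comod k C} (f : V ⟶ W) : V →ₗ[ConvDual k C] W where
  toFun := f.lin
  map_add' := map_add f.lin
  map_smul' ξ x := by
    rw [RingHom.id_apply, smul_eq_slice, smul_eq_slice, ← slice_rTensor]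
    exact congrArg _ (LinearMap.congr_fun f.colinear x)

/-- A linear map over the dual algebra as a morphism of comodules. -/
noncomputable def homOfConvDualLinear {V W : Comod k C} (f : V →ₗ[ConvDual k C] W) : V ⟶ W where
  lin := f.restrictScalars k
  colinear := LinearMap.ext fun x => eq_of_slice_eq fun ξ =>
    (slice_rTensor ξ _ _).trans (map_smul f (WithConv.toConv ξ) x)

/-- A subcoalgebra of `C` as a submodule over the dual algebra. -/
def submoduleOfSubcoalgebra {D : Submodule k C} (hD : IsSubcoalgebra k D) :
    Submodule (ConvDual k C) (unit k C) where
  carrier := {x : C | x ∈ D}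
  add_mem' := D.add_mem
  zero_mem' := D.zero_mem
  smul_mem' ξ _ hx := hD.slice_mem hx ξ.ofConv

variable [Coalgebra.IsCocomm k C]

theorem isSubcoalgebra_restrictScalars (N : Submodule (ConvDual k C) (unit k C)) :
    IsSubcoalgebra k (show Submodule k C from N.restrictScalars k) :=
  isSubcoalgebra_of_slice_mem fun x (hx : x ∈ N.restrictScalars k) ξ =>
    N.smul_mem (WithConv.toConv ξ) hx

theorem isSimpleModule_submoduleOfSubcoalgebra {D : Submodule k C}
    (hD : IsSimpleSubcoalgebra k D) :
    IsSimpleModule (ConvDual k C) (submoduleOfSubcoalgebra hD.isSubcoalgebra) := by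
  refine isSimpleModule_iff_isAtom.2 ⟨fun h => hD.ne_bot ?_, fun N hN => ?_⟩
  · exact congrArg (Submodule.restrictScalars (M := unit k C) k) h
  · refine (hD.eq_bot_or_eq (N.restrictScalars k) (fun x hx => hN.le hx)
      (isSubcoalgebra_restrictScalars N)).elim (fun h => ?_) fun h => ?_
    · exact Submodule.restrictScalars_injective k _ _ h
    · exact absurd (Submodule.restrictScalars_injective k _ _ h) hN.ne

theorem isSemisimpleModule_unit (hC : IsCosemisimple k C) :
    IsSemisimpleModule (ConvDual k C) (unit k C) := by
  obtain ⟨ι, D, hD, -, iSup_D⟩ := hC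
  let p (i : ι) := submoduleOfSubcoalgebra (hD i).isSubcoalgebra
  refine isSemisimpleModule_of_isSemisimpleModule_submodule' (p := p) (fun i => ?_) ?_
  · have := isSimpleModule_submoduleOfSubcoalgebra (hD i)
    infer_instance
  · have le_iSup_p : ⨆ i, D i ≤ (⨆ i, p i).restrictScalars k :=
      iSup_le fun i x (hx : x ∈ p i) => le_iSup p i hx
    exact eq_top_iff.2 fun x _ => le_iSup_p (iSup_D ▸ Submodule.mem_top)

theorem isSemisimpleModule_free (hC : IsCosemisimple k C) (M : Type u) [AddCommGroup M]
    [Module k M] : IsSemisimpleModule (ConvDual k C) (free M (unit k C)) := by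
  have := isSemisimpleModule_unit hC
  let p (m : M) := LinearMap.range (Hom.toConvDualLinear (freeMk m (unit k C)))
  refine isSemisimpleModule_of_isSemisimpleModule_submodule' (p := p)
    (fun m => IsSemisimpleModule.range _) (eq_top_iff.2 fun x _ => ?_)
  induction (show M ⊗[k] C from x) using TensorProduct.induction_on with
  | zero => exact Submodule.zero_mem _
  | add y z hy hz => exact Submodule.add_mem _ hy hz
  | tmul m c => exact Submodule.mem_iSup_of_mem m ⟨c, rfl⟩

theorem isSplitMono_coactHom (hC : IsCosemisimple k C) (V : Comod k C) :
    IsSplitMono (coactHom V) := by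
  have := isSemisimpleModule_free hC V
  obtain ⟨r, hr⟩ := IsSemisimpleModule.extension_property (Hom.toConvDualLinear (coactHom V))
    (Function.LeftInverse.injective (g := evC V) (LinearMap.congr_fun (evC_coact V))) LinearMap.id
  exact ⟨⟨homOfConvDualLinear r, hom_ext (LinearMap.ext fun x => LinearMap.congr_fun hr x)⟩⟩

end Comod

end Semisimple

/-! ### The closed structure -/

section Retract

variable {𝒞 : Type u₁} [Category.{v₁} 𝒞] [IsIdempotentComplete 𝒞]
  {𝒟 : Type u₂} [Category.{v₂} 𝒟] {F G : 𝒞 ⥤ 𝒟}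

theorem isLeftAdjoint_of_retract (h : Retract F G) [G.IsLeftAdjoint] : F.IsLeftAdjoint := by
  have i_comp_r (X : 𝒞) : h.i.app X ≫ h.r.app X = 𝟙 (F.obj X) := congr_app h.retract X
  let adj := Adjunction.ofIsLeftAdjoint G
  -- `h.r ≫ h.i` is an idempotent of `G`; its mate `e` is one of the right adjoint of `G`.
  let e (Y : 𝒟) : G.rightAdjoint.obj Y ⟶ G.rightAdjoint.obj Y :=
    adj.homEquiv _ Y (h.r.app _ ≫ h.i.app _ ≫ adj.counit.app Y)
  have homEquiv_comp_e {X : 𝒞} {Y : 𝒟} (u : G.obj X ⟶ Y) :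
      adj.homEquiv X Y u ≫ e Y = adj.homEquiv X Y (h.r.app X ≫ h.i.app X ≫ u) := by
    rw [← adj.homEquiv_naturality_left, h.r.naturality_assoc, h.i.naturality_assoc]
    simp [Adjunction.homEquiv_unit]
  have e_comp_e (Y : 𝒟) : e Y ≫ e Y = e Y := by
    rw [homEquiv_comp_e, reassoc_of% i_comp_r]
  choose R s t s_comp_t t_comp_s using fun Y =>
    IsIdempotentComplete.idempotents_split _ (e Y) (e_comp_e Y)
  let homEquiv (X : 𝒞) (Y : 𝒟) : (F.obj X ⟶ Y) ≃ (X ⟶ R Y) :=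
    { toFun := fun f => adj.homEquiv X Y (h.r.app X ≫ f) ≫ t Y
      invFun := fun g => h.i.app X ≫ (adj.homEquiv X Y).symm (g ≫ s Y)
      left_inv := fun f => by
        dsimp only
        rw [Category.assoc, t_comp_s, homEquiv_comp_e, Equiv.symm_apply_apply,
          reassoc_of% i_comp_r, reassoc_of% i_comp_r]
      right_inv := fun g => by
        have comp_e : (g ≫ s Y) ≫ e Y = g ≫ s Y := by
          rw [← t_comp_s, Category.assoc, reassoc_of% s_comp_t]
        dsimp only
        rw [← homEquiv_comp_e, Equiv.apply_symm_apply, comp_e, Category.assoc, s_comp_t,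
          Category.comp_id] }
  exact (Adjunction.adjunctionOfEquivRight homEquiv fun X' X Y f g => by
    simp only [homEquiv, Equiv.coe_fn_mk, ← h.r.naturality_assoc, adj.homEquiv_naturality_left,
      Category.assoc]).isLeftAdjoint

end Retract

variable {k : Type u} [Field k]

section SecondFactor

variable {C M N P : Type u} [AddCommGroup C] [Module k C] [AddCommGroup M] [Module k M]
  [AddCommGroup N] [Module k N] [AddCommGroup P] [Module k P]

theorem rightComm_comp_actL_actR (c : N →ₗ[k] N ⊗[k] C) :
    (TensorProduct.rightComm k M N P).toLinearMap.rTensor C ∘ₗ actL (actR M c) P =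
      actR (M ⊗[k] P) c ∘ₗ (TensorProduct.rightComm k M N P).toLinearMap := by
  ext m n p
  simp only [actL, actR, TensorProduct.AlgebraTensorModule.curry_apply,
    LinearMap.restrictScalars_self, TensorProduct.curry_apply, LinearMap.comp_apply,
    LinearEquiv.coe_coe, LinearMap.rTensor_tmul, LinearMap.lTensor_tmul,
    TensorProduct.rightComm_tmul]
  induction c n using TensorProduct.induction_on with
  | zero => simp
  | tmul x c => simp
  | add x y hx hy => simp only [TensorProduct.add_tmul, TensorProduct.tmul_add, map_add, hx, hy]

theorem rightComm_comp_actR (c : P →ₗ[k] P ⊗[k] C) :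
    (TensorProduct.rightComm k M N P).toLinearMap.rTensor C ∘ₗ actR (M ⊗[k] N) c =
      actL (actR M c) N ∘ₗ (TensorProduct.rightComm k M N P).toLinearMap := by
  let σ := TensorProduct.rightComm k M N P
  apply Comod.comp_cancel_right σ.symm.surjective
  calc (σ.toLinearMap.rTensor C ∘ₗ actR (M ⊗[k] N) c) ∘ₗ σ.symm.toLinearMap
      = σ.toLinearMap.rTensor C ∘ₗ σ.symm.toLinearMap.rTensor C ∘ₗ actL (actR M c) N :=
        congrArg (σ.toLinearMap.rTensor C ∘ₗ ·) (rightComm_comp_actL_actR c).symm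
    _ = (actL (actR M c) N ∘ₗ σ.toLinearMap) ∘ₗ σ.symm.toLinearMap := by
        rw [← LinearMap.comp_assoc, ← LinearMap.rTensor_comp, LinearMap.comp_assoc,
          LinearEquiv.comp_symm, LinearMap.rTensor_id, LinearMap.id_comp, LinearMap.comp_id]

theorem slice_rightComm (ξ : Module.Dual k C) (z : (M ⊗[k] N) ⊗[k] C) :
    (slice M ξ).rTensor N (TensorProduct.rightComm k M N C z) = slice (M ⊗[k] N) ξ z := by
  have h : (slice M ξ).rTensor N ∘ₗ (TensorProduct.rightComm k M N C).toLinearMap =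
      slice (M ⊗[k] N) ξ := by
    ext; simp [TensorProduct.smul_tmul']
  exact LinearMap.congr_fun h z

end SecondFactor

variable {C : Type u} [AddCommGroup C] [Module k C] [Coalgebra k C]

theorem slice_counit_comp_actR_comul (M : Type u) [AddCommGroup M] [Module k M] :
    (slice M (Coalgebra.counit (R := k))).rTensor C ∘ₗ actR M Coalgebra.comul =
      LinearMap.id := by
  have slice_assoc : (slice M (Coalgebra.counit (R := k) (A := C))).rTensor C ∘ₗ
      (TensorProduct.assoc k M C C).symm.toLinearMap =
        (TensorProduct.lid k C ∘ₗ (Coalgebra.counit (R := k)).rTensor C).lTensor M := by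
    ext; simp [TensorProduct.smul_tmul]
  rw [actR, ← LinearMap.comp_assoc, slice_assoc, ← LinearMap.lTensor_comp, LinearMap.comp_assoc,
    Coalgebra.rTensor_counit_comp_comul]
  ext
  simp

namespace Comod

section Equalizer

variable {V W : Comod k C} (f g : V ⟶ W)

/-- The equalizer of two morphisms of comodules: the subspace on which they agree. -/
noncomputable def eqLocus : Comod k C :=
  let K := LinearMap.eqLocus f.lin g.lin
  have coact_mem_range (x : K) : V.coact x ∈ LinearMap.range (K.subtype.rTensor C) :=
    mem_range_rTensor rfl _ <| (LinearMap.congr_fun f.colinear x).trans <|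
      (congrArg W.coact x.2).trans (LinearMap.congr_fun g.colinear x).symm
  have subtype_coact := comp_liftInj (K.subtype.rTensor C)
    (rTensor_inj K.injective_subtype C) (V.coact ∘ₗ K.subtype) coact_mem_range
  { carrier := K
    coact := liftInj _ (rTensor_inj K.injective_subtype C) (V.coact ∘ₗ K.subtype) coact_mem_range
    coassoc := isCoassoc_of_inj K.injective_subtype subtype_coact V.coassoc
    counital := isCounital_of_inj K.injective_subtype subtype_coact V.counital }

/-- The inclusion of the equalizer. -/
noncomputable def eqLocusι : eqLocus f g ⟶ V where
  lin := (LinearMap.eqLocus f.lin g.lin).subtype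
  colinear := comp_liftInj _ _ _ _

theorem eqLocusι_injective : Function.Injective (eqLocusι f g).lin :=
  Subtype.val_injective

theorem eqLocusι_comp : eqLocusι f g ≫ f = eqLocusι f g ≫ g :=
  hom_ext (LinearMap.ext fun x => x.2)

variable {f g} in
/-- The morphism to the equalizer of `f` and `g` induced by one that equalizes them. -/
noncomputable def eqLocusLift {Z : Comod k C} (s : Z ⟶ V) (hs : s ≫ f = s ≫ g) :
    Z ⟶ eqLocus f g :=
  let l : Z →ₗ[k] eqLocus f g := s.lin.codRestrict (LinearMap.eqLocus f.lin g.lin)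
    fun z => LinearMap.congr_fun (congrArg Hom.lin hs) z
  let ι := eqLocusι f g
  { lin := l
    colinear := comp_cancel (rTensor_inj (eqLocusι_injective f g) C) <|
      calc ι.lin.rTensor C ∘ₗ l.rTensor C ∘ₗ Z.coact
        _ = s.lin.rTensor C ∘ₗ Z.coact := by
          rw [← LinearMap.comp_assoc, ← LinearMap.rTensor_comp]; rfl
        _ = V.coact ∘ₗ ι.lin ∘ₗ l := s.colinear
        _ = ι.lin.rTensor C ∘ₗ (eqLocus f g).coact ∘ₗ l := by
          rw [← LinearMap.comp_assoc, ← ι.colinear, LinearMap.comp_assoc] }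

instance : Limits.HasEqualizers (Comod k C) :=
  have {V W : Comod k C} {f g : V ⟶ W} : Limits.HasLimit (Limits.parallelPair f g) :=
    ⟨⟨⟨Limits.Fork.ofι (eqLocusι f g) (eqLocusι_comp f g),
      Limits.Fork.IsLimit.mk _ (fun s => eqLocusLift s.ι s.condition) (fun _ => rfl)
        fun _ _ hm => hom_ext (comp_cancel (eqLocusι_injective f g) (congrArg Hom.lin hm))⟩⟩⟩
  Limits.hasEqualizers_of_hasLimit_parallelPair _

instance : IsIdempotentComplete (Comod k C) :=
  (Idempotents.isIdempotentComplete_iff_hasEqualizer_of_id_and_idempotent _).2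
    fun _ _ _ => inferInstance

end Equalizer

section Cofree

variable (k C) in
/-- The functor that forgets the coaction. -/
noncomputable def forget : Comod k C ⥤ ModuleCat.{u} k where
  obj V := ModuleCat.of k V
  map f := ModuleCat.ofHom f.lin

/-- The map `f ⊗ V` as a morphism `M ⊗ V ⟶ N ⊗ V`. -/
noncomputable def freeMap {M N : Type u} [AddCommGroup M] [Module k M] [AddCommGroup N]
    [Module k N] (f : M →ₗ[k] N) (V : Comod k C) : free M V ⟶ free N V where
  lin := f.rTensor V
  colinear := actR_map f LinearMap.id (b := V.coact) (b' := V.coact) (by simp)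

variable (k C) in
/-- The cofree comodule functor `M ↦ M ⊗ C`. -/
noncomputable def cofree : ModuleCat.{u} k ⥤ Comod k C where
  obj M := free M (unit k C)
  map f := freeMap f.hom (unit k C)
  map_id M := hom_ext (LinearMap.rTensor_id C M)
  map_comp f g := hom_ext (LinearMap.rTensor_comp C g.hom f.hom)

variable (k C) in
/-- A morphism `V ⟶ M ⊗ C` is determined by the linear map `V → M` obtained by applying the
counit of `C`. -/
noncomputable def forgetAdjCofree : forget k C ⊣ cofree k C :=
  Adjunction.mkOfUnitCounit
    { unit :=
        { app := coactHom
          naturality := fun _ _ f => hom_ext f.colinear.symm }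
      counit :=
        { app := fun M => ModuleCat.ofHom (slice M (Coalgebra.counit (R := k) (A := C)))
          naturality := fun _ _ f => ModuleCat.hom_ext (LinearMap.ext (slice_rTensor _ f.hom)) }
      left_triangle := NatTrans.ext <| funext fun V => ModuleCat.hom_ext (evC_coact V)
      right_triangle := NatTrans.ext <| funext fun M =>
        hom_ext (slice_counit_comp_actR_comul (k := k) (C := C) M) }

instance : (forget k C).IsLeftAdjoint :=
  (forgetAdjCofree k C).isLeftAdjoint

end Cofree

section CotensorCofree

variable (M : Type u) [AddCommGroup M] [Module k M] (X : Comod k C)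

/-- The coaction of `M ⊗ X`, with its value in `(M ⊗ C) ⊗ X`. -/
noncomputable def spread : M ⊗[k] X →ₗ[k] (M ⊗[k] C) ⊗[k] X :=
  (TensorProduct.rightComm k M X C).toLinearMap ∘ₗ actR M X.coact

theorem spread_comp_actR_eq_actL :
    (spread M X).rTensor C ∘ₗ actR M X.coact =
      actL (actR M Coalgebra.comul) X ∘ₗ spread M X := by
  have coassoc : (actR M X.coact).rTensor C ∘ₗ actR M X.coact =
    actR (M ⊗[k] X) Coalgebra.comul ∘ₗ actR M X.coact := coact_actR (free M X)
  rw [spread, LinearMap.rTensor_comp, LinearMap.comp_assoc, coassoc, ← LinearMap.comp_assoc,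
    rightComm_comp_actR, LinearMap.comp_assoc]

theorem slice_counit_comp_spread :
    (slice M (Coalgebra.counit (R := k))).rTensor X ∘ₗ spread M X = LinearMap.id :=
  LinearMap.ext fun z => (slice_rightComm _ _).trans (LinearMap.congr_fun (evC_coact (free M X)) z)

variable {M X} in
theorem spread_slice_counit {z : (M ⊗[k] C) ⊗[k] X}
    (hz : actL (actR M Coalgebra.comul) X z = actR (M ⊗[k] C) X.coact z) :
    spread M X ((slice M (Coalgebra.counit (R := k))).rTensor X z) = z := by
  let φ := (slice M (Coalgebra.counit (R := k) (A := C))).rTensor X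
  have φ_actR : φ.rTensor C ∘ₗ actR (M ⊗[k] C) X.coact = actR M X.coact ∘ₗ φ :=
    actR_map _ LinearMap.id (by simp)
  have φ_actL : φ.rTensor C ∘ₗ actL (actR M Coalgebra.comul) X =
      (TensorProduct.rightComm k M C X).toLinearMap := by
    have φ_rightComm : φ.rTensor C ∘ₗ (TensorProduct.rightComm k (M ⊗[k] C) C X).toLinearMap =
        (TensorProduct.rightComm k M C X).toLinearMap ∘ₗ
          ((slice M Coalgebra.counit).rTensor C).rTensor X := by
      ext; simp [φ]
    rw [actL, ← LinearMap.comp_assoc, φ_rightComm, LinearMap.comp_assoc, ← LinearMap.rTensor_comp,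
      slice_counit_comp_actR_comul, LinearMap.rTensor_id, LinearMap.comp_id]
  calc spread M X (φ z)
    _ = TensorProduct.rightComm k M X C (φ.rTensor C (actR (M ⊗[k] C) X.coact z)) :=
      congrArg _ (LinearMap.congr_fun φ_actR z).symm
    _ = TensorProduct.rightComm k M X C (TensorProduct.rightComm k M C X z) := by
      rw [← hz]
      exact congrArg _ (LinearMap.congr_fun φ_actL z)
    _ = z := (TensorProduct.rightComm k M C X).symm_apply_apply z

variable [Coalgebra.IsCocomm k C]

theorem spread_comp_actR_eq_actR :
    (spread M X).rTensor C ∘ₗ actR M X.coact = actR (M ⊗[k] C) X.coact ∘ₗ spread M X := by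
  have coassoc : (actR M X.coact).rTensor C ∘ₗ actR M X.coact =
    actL (actR M X.coact) C ∘ₗ actR M X.coact := coact_actL (free M X)
  rw [spread, LinearMap.rTensor_comp, LinearMap.comp_assoc, coassoc, ← LinearMap.comp_assoc,
    rightComm_comp_actL_actR, LinearMap.comp_assoc]

/-- The underlying space of the cotensor product of a cofree comodule `M ⊗ C` with `X`. -/
noncomputable def cotensorFreeEquiv : cotensor (free M (unit k C)) X ≃ₗ[k] M ⊗[k] X :=
  LinearEquiv.ofLinearMap
    ((slice M (Coalgebra.counit (R := k) (A := C))).rTensor X ∘ₗ incl (free M (unit k C)) X)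
    (liftLin (Z := free M X) (spread M X)
      ((spread_comp_actR_eq_actL M X).symm.trans (spread_comp_actR_eq_actR M X)))
    (slice_counit_comp_spread M X)
    (comp_cancel (incl_injective _ X) <| LinearMap.ext fun z =>
      spread_slice_counit (LinearMap.congr_fun (actL_inc (free M (unit k C)) X) z))

/-- The forgetful functor takes the cotensor product with `M ⊗ C` to the tensor product
with `M`. -/
noncomputable def tensorLeftFreeIso :
    tensorLeft (free M (unit k C)) ⋙ forget k C ≅ forget k C ⋙ tensorLeft (ModuleCat.of k M) :=
  NatIso.ofComponents (fun X => (cotensorFreeEquiv M X).toModuleIso) fun {X Y} f => by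
    let ε := slice M (Coalgebra.counit (R := k) (A := C))
    have rTensor_lTensor : ε.rTensor Y ∘ₗ f.lin.lTensor (M ⊗[k] C) =
        f.lin.lTensor M ∘ₗ ε.rTensor X := by
      rw [LinearMap.rTensor_comp_lTensor, LinearMap.lTensor_comp_rTensor]
    exact ModuleCat.hom_ext (congrArg (· ∘ₗ incl (free M (unit k C)) X) rTensor_lTensor)

theorem isLeftAdjoint_tensorLeft_free (hC : IsCosemisimple k C) :
    (tensorLeft (free M (unit k C))).IsLeftAdjoint := by
  have := ((Adjunction.ofIsLeftAdjoint (forget k C ⋙ tensorLeft (ModuleCat.of k M))).ofNatIsoLeft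
    (tensorLeftFreeIso M).symm).isLeftAdjoint
  refine isLeftAdjoint_triangle_lift (tensorLeft (free M (unit k C))) (forgetAdjCofree k C)
    fun X => ?_
  have := isSplitMono_coactHom hC X
  exact .ofIsSplitMono (coactHom X)

theorem isLeftAdjoint_tensorLeft (hC : IsCosemisimple k C) (V : Comod k C) :
    (tensorLeft V).IsLeftAdjoint := by
  have := isSplitMono_coactHom hC V
  have := isLeftAdjoint_tensorLeft_free V hC
  exact isLeftAdjoint_of_retract
    (Retract.map ⟨coactHom V, retraction (coactHom V), IsSplitMono.id _⟩
      (curriedTensor (Comod k C)))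

/-- The internal homs of comodules over a cosemisimple coalgebra. -/
noncomputable abbrev monoidalClosed (hC : IsCosemisimple k C) : MonoidalClosed (Comod k C) where
  closed V :=
    have := isLeftAdjoint_tensorLeft hC V
    { rightAdj := (tensorLeft V).rightAdjoint
      adj := Adjunction.ofIsLeftAdjoint (tensorLeft V) }

end CotensorCofree

end Comod

section LNL

variable {𝒞 : Type u₁} [Category.{v₁} 𝒞] [CartesianMonoidalCategory 𝒞]
  {ℳ : Type u₂} [Category.{v₂} ℳ] [MonoidalCategory ℳ] [SymmetricCategory ℳ]

theorem exists_lnlAdjunction_isStrong (closed : MonoidalClosed ℳ) {F : 𝒞 ⥤ ℳ} [F.Monoidal]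
    {G : ℳ ⥤ 𝒞} (adj : F ⊣ G) : ∃ L : LNLAdjunction F G, L.IsStrong := by
  let := adj.rightAdjointLaxMonoidal
  exact ⟨
    { cartesian := inferInstance
      closed := closed
      adj := adj
      laxU := inferInstance
      laxR := inferInstance
      unit_isMonoidal := inferInstance
      counit_isMonoidal := inferInstance },
    (inferInstance : IsIso (Functor.LaxMonoidal.ε F)),
    fun X Y => (inferInstance : IsIso (Functor.LaxMonoidal.μ F X Y))⟩

end LNL

end ComodLNL

theorem mainTheorem2 (k : Type u) [Field k] (C : Type u) [AddCommGroup C] [Module k C]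
    [Coalgebra k C] [Coalgebra.IsCocomm k C] (hC : ComodLNL.IsCosemisimple k C) :
    ∃ (R : ComodLNL.Comod k C ⥤ ComodLNL.CoalgOver k C)
      (L : ComodLNL.LNLAdjunction (ComodLNL.U k C) R), L.IsStrong := by
  exact ⟨_, ComodLNL.exists_lnlAdjunction_isStrong (ComodLNL.Comod.monoidalClosed hC)
    (adjunctionOfCostructuredArrowTerminals (ComodLNL.U k C))⟩
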